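/- Let $(\Omega,\mu)$ be a probability space and let $T_t=e^{-At}:L_\infty(\Omega,\mu)\to L_\infty(\Omega,\mu)$, $t\ge 0$, be a symmetric Markov semigroup: each $T_t$ is a normal, positive, unital linear map that is self-adjoint for the inner product of $L_2(\mu)$, $T_0=\mathrm{id}$, $T_{s+t}=T_sT_t$, and $t\mapsto T_tf$ is ultraweakly continuous for every $f$. Let $Af=\lim_{t\downarrow 0}\frac1t(f-T_tf)$ (limit in $L_2$) be its positive generator, and let $\mathcal A=\operatorname{dom}(A^{1/2})\cap L_\infty$ be its Dirichlet algebra. Suppose that * $T_t$ is ergodic: the only $f\in L_\infty$ with $T_tf=f$ for all $t\geq 0$ are the constants; * $T_t$ is a diffusion: for $f,g\in\mathcal A$ the gradient form $\Gamma(f,g)=\frac12\big((Af)g+f(Ag)-A(fg)\big)$ exists as an element of $L_1(\mu)$ (as the $L_1$-limit, for $t\downarrow0$, of the same expression with $A$ replaced by $\frac1t(\mathrm{id}-T_t)$), and $\Gamma(fh,g)=f\,\Gamma(h,g)+h\,\Gamma(f,g)$ for all $f,g,h\in\mathcal A$; * $T_t$ satisfies $CD(\lambda,\infty)$ for some $\lambda\in\mathbb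 R$: $\Gamma_2(f)\ge\lambda\,\Gamma(f,f)$, where $\Gamma_2(f)=\frac12\big(\Gamma(Af,f)+\Gamma(f,Af)-A\Gamma(f,f)\big)$, in the weak sense that $$\frac12\Big(\int\varphi\,\Gamma(Af,f)\,d\mu+\int\varphi\,\Gamma(f,Af)\,d\mu-\int (A\varphi)\,\Gamma(f,f)\,d\mu\Big)\ \ge\ \lambda\int\varphi\,\Gamma(f,f)\,d\mu$$ for all $f\in\operatorname{dom}(A)\cap L_\infty$ with $Af\in\mathcal A$ and all $0\le\varphi\in\operatorname{dom}(A)\cap L_\infty$ with $A\varphi\in L_\infty$; * for some $c,d>0$, $\|T_t:L_1(\Omega)\to L_\infty(\Omega)\|\le c\,t^{-d/2}$ for all $0<t<1$; * $A$ has spectral gap $\sigma>0$: $\|f-\int f\,d\mu\|_2\le\sigma^{-1}\|Af\|_2$ for all $f\in\operatorname{dom}(A)$. Then $T_t$ satisfies the $m(\lambda)$-modified logarithmic Sobolev inequality with $$m(\lambda)=\begin{cases}\Big(2+\frac{2(d+2)}{\sigma}\log 2+\frac4\sigma\log c\Big)^{-1},&\lambda=0,\\[4pt] \lambda\Big(2-e^{-\lambda}\,2^{\,1-(d+2)\lambda/\sigma}\,c^{-2\lambda/\sigma}\Big)^{-1},&\lambda\ne0,\end{cases}$$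 that is, $m(\lambda)>0$ and $$2\,m(\lambda)\int\rho\log\rho\,d\mu\ \le\ \int (A\rho)\log\rho\,d\mu$$ for every probability density $\rho\in\operatorname{dom}(A)$ with $a\le\rho\le b$ almost everywhere for some constants $a,b>0$. -/

import Mathlib

open MeasureTheory Filter Topology
open scoped ENNReal

noncomputable section

namespace DiffusionMLSI

variable {Ω : Type*} [MeasurableSpace Ω] {μ : Measure Ω}

/-- The real algebra `L_∞(Ω, μ)`. -/
abbrev Linf (μ : Measure Ω) : Type _ := Lp ℝ ∞ μ

/-- The pointwise product of two bounded functions, as an element of `L_∞(Ω, μ)`. -/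
def mulLinf (f g : Linf μ) : Linf μ :=
  MemLp.toLp (fun x => f x * g x) ((Lp.memLp g).mul' (Lp.memLp f))

/-- A Markov semigroup `(T_t)_{t ≥ 0}` on `L_∞(Ω, μ)`; only the values at times `t ≥ 0` matter.
On a commutative algebra complete positivity is positivity. A map of `L_∞` is normal if and only
if it has a pre-adjoint on `L_1`, which is what `normal` says. The ultraweak topology of `L_∞` is
given by the pairings with integrable functions. -/
structure IsMarkovSemigroup [IsFiniteMeasure μ] (T : ℝ → Linf μ →L[ℝ] Linf μ) : Prop where
  nonneg : ∀ t, 0 ≤ t → ∀ f : Linf μ, 0 ≤ f → 0 ≤ T t f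
  unital : ∀ t, 0 ≤ t → T t (Lp.const ∞ μ (1 : ℝ)) = Lp.const ∞ μ (1 : ℝ)
  normal : ∀ t, 0 ≤ t → ∀ g : Ω → ℝ, Integrable g μ → ∃ h : Ω → ℝ, Integrable h μ ∧
    ∀ f : Linf μ, ∫ x, g x * T t f x ∂μ = ∫ x, h x * f x ∂μ
  zero : T 0 = ContinuousLinearMap.id ℝ (Linf μ)
  add : ∀ s t, 0 ≤ s → 0 ≤ t → T (s + t) = (T s).comp (T t)
  ultraweak_continuous : ∀ f : Linf μ, ∀ g : Ω → ℝ, Integrable g μ →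
    ContinuousOn (fun t => ∫ x, g x * T t f x ∂μ) (Set.Ici 0)

/-- Every `T_t` is self-adjoint for the inner product of `L_2(Ω, μ)`. -/
def IsSymmetricSemigroup (T : ℝ → Linf μ →L[ℝ] Linf μ) : Prop :=
  ∀ t, 0 ≤ t → ∀ f g : Linf μ, ∫ x, f x * T t g x ∂μ = ∫ x, T t f x * g x ∂μ

/-- The fixed-point algebra consists of the constants. -/
def IsErgodicSemigroup [IsFiniteMeasure μ] (T : ℝ → Linf μ →L[ℝ] Linf μ) : Prop :=
  ∀ f : Linf μ, (∀ t, 0 ≤ t → T t f = f) → ∃ a : ℝ, f = Lp.const ∞ μ a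

/-- `HasGenerator T f g`: the bounded function `f` is in the domain of the (positive) generator `A`
of the semigroup on `L_2(Ω, μ)`, and `A f = g`, i.e. `(f - T_t f) / t → g` in `L_2` as `t ↓ 0`.
Bounded functions form a core of the generator. -/
def HasGenerator (T : ℝ → Linf μ →L[ℝ] Linf μ) (f : Linf μ) (g : Ω → ℝ) : Prop :=
  MemLp g 2 μ ∧
    Tendsto (fun t : ℝ => eLpNorm (fun x => (f x - T t f x) / t - g x) 2 μ) (𝓝[>] 0) (𝓝 0)

/-- `f` lies in the Dirichlet algebra `dom(A^{1/2}) ∩ L_∞`: the approximating Dirichlet forms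
`⟨f, f - T_t f⟩ / t`, which increase to `𝓔(f, f)` as `t ↓ 0`, stay bounded. -/
def InDirichletAlgebra (T : ℝ → Linf μ →L[ℝ] Linf μ) (f : Linf μ) : Prop :=
  ∃ C : ℝ, ∀ t : ℝ, 0 < t → (∫ x, f x * (f x - T t f x) ∂μ) / t ≤ C

/-- The gradient form `((A_t f) g + f (A_t g) - A_t (f g)) / 2` of `A_t = (id - T_t) / t`. -/
def approxGamma (T : ℝ → Linf μ →L[ℝ] Linf μ) (t : ℝ) (f g : Linf μ) (x : Ω) : ℝ :=
  ((f x - T t f x) / t * g x + f x * ((g x - T t g x) / t)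
    - (mulLinf f g x - T t (mulLinf f g) x) / t) / 2

/-- `HasGamma T f g γ`: the gradient form (carré du champ)
`Γ(f, g) = ((A f) g + f (A g) - A (f g)) / 2` exists in `L_1(Ω, μ)` and equals `γ`; it is the
`L_1`-limit of the gradient forms of `A_t = (id - T_t) / t` as `t ↓ 0`. -/
def HasGamma (T : ℝ → Linf μ →L[ℝ] Linf μ) (f g : Linf μ) (γ : Ω → ℝ) : Prop :=
  Integrable γ μ ∧
    Tendsto (fun t : ℝ => eLpNorm (fun x => approxGamma T t f g x - γ x) 1 μ) (𝓝[>] 0) (𝓝 0)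

/-- The diffusion property: the gradient form exists on the Dirichlet algebra and satisfies
`Γ(f h, g) = f Γ(h, g) + h Γ(f, g)`. -/
structure IsDiffusion (T : ℝ → Linf μ →L[ℝ] Linf μ) : Prop where
  exists_gamma : ∀ f g : Linf μ, InDirichletAlgebra T f → InDirichletAlgebra T g →
    ∃ γ : Ω → ℝ, HasGamma T f g γ
  product_rule : ∀ f h g : Linf μ, InDirichletAlgebra T f → InDirichletAlgebra T h →
    InDirichletAlgebra T g → ∀ γhg γfg : Ω → ℝ, HasGamma T h g γhg → HasGamma T f g γfg →
      HasGamma T (mulLinf f h) g (fun x => f x * γhg x + h x * γfg x)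

/-- The curvature-dimension condition `CD(lam, ∞)`, i.e. `Γ₂(f) ≥ lam Γ(f)` with
`Γ₂(f) = (Γ(A f, f) + Γ(f, A f) - A Γ(f, f)) / 2`. As `Γ(f, f)` is in general only an `L_1`
function, the inequality is tested against bounded `φ ≥ 0` with `A φ` bounded, and `A` is moved
to `φ` by symmetry; `f` runs over the bounded functions in the domain of `A` for which `A f` is
in the Dirichlet algebra, so that `Γ(A f, f)` is defined. -/
def CurvatureDimension (T : ℝ → Linf μ →L[ℝ] Linf μ) (lam : ℝ) : Prop :=
  ∀ f Af : Linf μ, HasGenerator T f Af → InDirichletAlgebra T Af →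
    ∀ γ γ₁ γ₂ : Ω → ℝ, HasGamma T f f γ → HasGamma T Af f γ₁ → HasGamma T f Af γ₂ →
      ∀ φ Aφ : Linf μ, 0 ≤ φ → HasGenerator T φ Aφ →
        lam * ∫ x, φ x * γ x ∂μ ≤
          (∫ x, φ x * γ₁ x ∂μ + ∫ x, φ x * γ₂ x ∂μ - ∫ x, Aφ x * γ x ∂μ) / 2

/-- `‖T_t : L_1 → L_∞‖ ≤ c t^{-d/2}` for `0 < t < 1` (it suffices to test on the dense subspace
`L_∞` of `L_1`). -/
def VaropoulosBound (T : ℝ → Linf μ →L[ℝ] Linf μ) (c d : ℝ) : Prop :=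
  ∀ t : ℝ, 0 < t → t < 1 → ∀ f : Linf μ, ‖T t f‖ ≤ c * t ^ (-(d / 2)) * ∫ x, |f x| ∂μ

/-- Spectral gap `σ`: `‖A⁻¹ (id - E) : L_2 → L_2‖ ≤ σ⁻¹` with `E f = ∫ f`, that is
`‖f - E f‖₂ ≤ σ⁻¹ ‖A f‖₂` on the domain of `A` (tested on its core of bounded functions). -/
def HasSpectralGap (T : ℝ → Linf μ →L[ℝ] Linf μ) (σ : ℝ) : Prop :=
  ∀ (f : Linf μ) (g : Ω → ℝ), HasGenerator T f g →
    eLpNorm (fun x => f x - ∫ y, f y ∂μ) 2 μ ≤ ENNReal.ofReal σ⁻¹ * eLpNorm g 2 μ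

/-- The `m`-modified logarithmic Sobolev inequality of an ergodic semigroup: `m > 0` and
`2 m D(ρ ‖ 1) ≤ I(ρ) = ∫ (A ρ) log ρ` for every probability density `ρ` in the domain of `A` that
is bounded and bounded away from zero. -/
def SatisfiesMLSI (T : ℝ → Linf μ →L[ℝ] Linf μ) (m : ℝ) : Prop :=
  0 < m ∧ ∀ (ρ : Linf μ) (Aρ : Ω → ℝ), (∃ a : ℝ, 0 < a ∧ ∀ᵐ x ∂μ, a ≤ ρ x) →
    ∫ x, ρ x ∂μ = 1 → HasGenerator T ρ Aρ →
      2 * m * ∫ x, ρ x * Real.log (ρ x) ∂μ ≤ ∫ x, Aρ x * Real.log (ρ x) ∂μ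

/-- The explicit constant `m(lam)`. -/
def mlsiConstant (c d σ lam : ℝ) : ℝ :=
  if lam = 0 then
    (2 + 2 * (d + 2) / σ * Real.log 2 + 4 / σ * Real.log c)⁻¹
  else
    lam * (2 - Real.exp (-lam) * 2 ^ (1 - (d + 2) * lam / σ) * c ^ (-(2 * lam / σ)))⁻¹

end DiffusionMLSI

end

/-! Write `D(ρ) = ∫ ρ log ρ`, `I(ρ) = ∫ (A ρ) log ρ` and `κ(t) = ∫₀ᵗ e^{-2 λ s} ds`. The inequality
combines two estimates along the flow. Curvature limits the entropy lost up to time `t`: `D(ρ) -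
D(T_t ρ) ≤ κ(t) I(ρ)` (`entropy_sub_le_fisher`). Mixing forces half of the entropy to be lost by an
explicit time `t₀`: `D(T_{t₀} ρ) ≤ D(ρ) / 2` (`entropy_half`). Together `D(ρ) / 2 ≤ κ(t₀) I(ρ)`,
which is the inequality with `m = 1 / (4 κ(t₀))`; `mlsiConstant_eq` identifies this number with the
stated constant.

Curvature. Since `-I` is the derivative of the entropy along the flow, it suffices that `I(T_t ρ) ≤
e^{-2 λ t} I(ρ)` (`fisher_decay`). The Bakry–Émery interpolation gives `Γ(T_t g) ≤ e^{-2 λ t} T_t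
Γ(g)` (`gradient_estimate`). With `g = log T_t ρ`, symmetry and the chain rule give `I(T_t ρ) = ∫
(T_t g) A ρ = ∫ ρ Γ(log ρ, T_t g)`. A weighted Cauchy–Schwarz inequality and the gradient estimate
bound this by `(e^{-2 λ t} I(ρ) + I(T_t ρ)) / 2`, and the last term is absorbed. The chain rule is
needed only for the exponential, `ρ = e^{log ρ}`, and follows from the Leibniz rule through Taylor
polynomials (`carreInt_exp`).

Mixing. Ultracontractivity takes `L_1` to `L_2` and `L_2` to `L_∞` in total time `1/2`, and the
spectral gap contracts the centered part exponentially in between. For `t₀ = 1/2 + τ` with suitable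
`τ` this yields `T_{t₀} f ≥ (1/2) ∫ f` for `f ≥ 0` (`half_expect_le_map`). Hence `T_{t₀}` is the
average of the expectation and another Markov operator, and convexity halves the entropy.

Regularity. The semigroup on `L_2` is symmetric, hence smoothing into the domain of `A`; followed by
the bounded map `L_2 → L_∞` this makes orbits differentiable in `L_∞` at positive times. Estimates
are proved there first, and the shifts in time are then removed by limits. -/

open MeasureTheory Filter Topology
open scoped ENNReal

set_option linter.unusedSectionVars false

noncomputable section

namespace DiffusionMLSI

/-! ### Symmetric contraction semigroups on a Hilbert space -/

section HilbertSemigroup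

variable {H : Type*} [NormedAddCommGroup H] [InnerProductSpace ℝ H]

/-- A strongly continuous semigroup of symmetric contractions of a real Hilbert space. -/
structure IsSymmContractionSemigroup (S : ℝ → H →L[ℝ] H) : Prop where
  zero : ∀ f, S 0 f = f
  add : ∀ s t, 0 ≤ s → 0 ≤ t → ∀ f, S (s + t) f = S s (S t f)
  -- No restriction to `t ≥ 0`: the semigroup to which this applies is frozen at negative times, so
  -- that orbits are continuous on the whole line.
  symm : ∀ t f g, inner ℝ (S t f) g = inner ℝ f (S t g)
  contr : ∀ t f, ‖S t f‖ ≤ ‖f‖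
  cont : ∀ f, Continuous fun t => S t f

/-- `g = A f` for the positive generator `A` of the semigroup `S`. -/
def IsGen (S : ℝ → H →L[ℝ] H) (f g : H) : Prop :=
  Tendsto (fun t : ℝ => t⁻¹ • (f - S t f)) (𝓝[>] 0) (𝓝 g)

namespace IsSymmContractionSemigroup

variable {S : ℝ → H →L[ℝ] H}

lemma comm (hS : IsSymmContractionSemigroup S)
    {s t : ℝ} (hs : 0 ≤ s) (ht : 0 ≤ t) (f : H) : S s (S t f) = S t (S s f) := by
  rw [← hS.add s t hs ht, ← hS.add t s ht hs, add_comm]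

lemma inner_self_nonneg (hS : IsSymmContractionSemigroup S)
    {t : ℝ} (ht : 0 ≤ t) (f : H) : 0 ≤ inner ℝ (S t f) f := by
  have : S t f = S (t / 2) (S (t / 2) f) := by
    rw [← hS.add _ _ (by positivity) (by positivity)]; congr 2; ring
  rw [this, hS.symm]
  exact real_inner_self_nonneg

lemma inner_eq_norm_sq (hS : IsSymmContractionSemigroup S) {t : ℝ} (ht : 0 ≤ t) (f : H) :
    inner ℝ (S (2 * t) f) f = ‖S t f‖ ^ 2 := by
  rw [two_mul, hS.add t t ht ht, hS.symm, real_inner_self_eq_norm_sq]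

lemma isGen_map (hS : IsSymmContractionSemigroup S)
    {f g : H} (h : IsGen S f g) {t : ℝ} (ht : 0 ≤ t) : IsGen S (S t f) (S t g) := by
  have h1 := ((S t).continuous.tendsto g).comp h
  refine h1.congr' ?_
  filter_upwards [self_mem_nhdsWithin] with s hs
  simp only [Function.comp, map_smul, map_sub]
  rw [hS.comm ht (le_of_lt hs)]

lemma isGen_inner_nonneg (hS : IsSymmContractionSemigroup S)
    {f g : H} (h : IsGen S f g) : 0 ≤ inner ℝ g f := by
  have h1 := Tendsto.inner (𝕜 := ℝ) h (tendsto_const_nhds (x := f))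
  refine ge_of_tendsto h1 ?_
  filter_upwards [self_mem_nhdsWithin] with s hs
  rw [real_inner_smul_left, inner_sub_left]
  have := real_inner_le_norm (S s f) f
  have h2 := hS.contr s f
  have : inner ℝ (S s f) f ≤ ‖f‖ * ‖f‖ :=
    this.trans (mul_le_mul_of_nonneg_right h2 (norm_nonneg _))
  have h3 : inner ℝ f f = ‖f‖ * ‖f‖ := real_inner_self_eq_norm_mul_norm f
  have : (0:ℝ) < s := hs
  have : 0 ≤ s⁻¹ := by positivity
  apply mul_nonneg this; linarith

variable [CompleteSpace H]

/-- The generator controls only right derivatives, but a continuous function with vanishing right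
derivative is constant; this applies to the orbit plus the primitive. -/
lemma orbit_eq (hS : IsSymmContractionSemigroup S)
    {f g : H} (h : IsGen S f g) {t : ℝ} (ht : 0 ≤ t) :
    f - S t f = ∫ s in (0:ℝ)..t, S s g := by
  have hc := hS.cont g
  have hderiv : ∀ x ∈ Set.Ico (0:ℝ) t,
      HasDerivWithinAt (fun x => S x f + ∫ s in (0:ℝ)..x, S s g) 0 (Set.Ici x) x := by
    intro x hx
    have h1 : HasDerivWithinAt (fun x => ∫ s in (0:ℝ)..x, S s g) (S x g) (Set.Ici x) x :=
      (hc.integral_hasStrictDerivAt 0 x).hasDerivAt.hasDerivWithinAt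
    have h2 : HasDerivWithinAt (fun x => S x f) (-(S x g)) (Set.Ici x) x := by
      rw [hasDerivWithinAt_iff_tendsto_slope]
      have h3 : Set.Ici x \ {x} = Set.Ioi x := by ext y; simp [lt_iff_le_and_ne]
      rw [h3]
      have h4 := (hS.isGen_map h hx.1).neg
      have h5 : Tendsto (fun y : ℝ => y - x) (𝓝[>] x) (𝓝[>] 0) := by
        refine tendsto_nhdsWithin_iff.2 ⟨?_, ?_⟩
        · have : Tendsto (fun y : ℝ => y - x) (𝓝 x) (𝓝 (x - x)) := by
            exact (continuous_id.sub continuous_const).tendsto x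
          rw [sub_self] at this
          exact this.mono_left nhdsWithin_le_nhds
        · filter_upwards [self_mem_nhdsWithin] with y hy
          simpa using hy
      refine (h4.comp h5).congr' ?_
      filter_upwards [self_mem_nhdsWithin] with y hy
      have hy' : x < y := hy
      simp only [Function.comp, slope, vsub_eq_sub]
      rw [← hS.add _ _ (by linarith) hx.1, ← smul_neg, neg_sub]
      congr 3; ring_nf
    have h6 := h2.add h1
    rw [neg_add_cancel] at h6
    exact h6
  have hcont : ContinuousOn (fun x => S x f + ∫ s in (0:ℝ)..x, S s g) (Set.Icc 0 t) :=
    ((hS.cont f).add (intervalIntegral.continuous_primitive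
      (fun a b => hc.intervalIntegrable a b) 0)).continuousOn
  have := constant_of_has_deriv_right_zero hcont hderiv t ⟨ht, le_rfl⟩
  simp only [intervalIntegral.integral_same, add_zero, hS.zero] at this
  rw [sub_eq_iff_eq_add, add_comm]; exact this.symm

/-- Converse of `orbit_eq`. The integrated form of `A f = g` passes to limits, which the difference
quotients do not do directly. -/
lemma isGen_of_orbit (hS : IsSymmContractionSemigroup S)
    {f g : H} (h : ∀ t, 0 ≤ t → f - S t f = ∫ s in (0:ℝ)..t, S s g) :
    IsGen S f g := by
  have h1 := ((hS.cont g).integral_hasStrictDerivAt 0 0).hasDerivAt.hasDerivWithinAt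
    (s := Set.Ioi 0)
  rw [hasDerivWithinAt_iff_tendsto_slope' (by simp), hS.zero] at h1
  refine h1.congr' ?_
  filter_upwards [self_mem_nhdsWithin] with s hs
  simp [slope, h s (le_of_lt hs)]

lemma hasDerivAt_orbit (hS : IsSymmContractionSemigroup S)
    {f g : H} (h : IsGen S f g) {t : ℝ} (ht : 0 < t) :
    HasDerivAt (fun t => S t f) (-(S t g)) t := by
  have h1 : HasDerivAt (fun t => f - ∫ s in (0:ℝ)..t, S s g) (-(S t g)) t := by
    simpa using ((hS.cont g).integral_hasStrictDerivAt 0 t).hasDerivAt.const_sub f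
  refine h1.congr_of_eventuallyEq ?_
  filter_upwards [lt_mem_nhds ht] with s hs
  rw [← hS.orbit_eq h hs.le]; abel

lemma isGen_integral (hS : IsSymmContractionSemigroup S) (f : H) {r : ℝ} (hr : 0 ≤ r) :
    IsGen S (∫ s in (0:ℝ)..r, S s f) (f - S r f) := by
  apply hS.isGen_of_orbit
  intro t ht
  have hi : ∀ a b : ℝ, IntervalIntegrable (fun s => S s f) volume a b :=
    fun a b => (hS.cont f).intervalIntegrable a b
  have e1 : S t (∫ s in (0:ℝ)..r, S s f) = ∫ s in t..(t + r), S s f := by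
    rw [← ContinuousLinearMap.intervalIntegral_comp_comm _ (hi _ _)]
    have : ∫ s in (0:ℝ)..r, S t (S s f) = ∫ s in (0:ℝ)..r, S (t + s) f := by
      apply intervalIntegral.integral_congr
      intro s hs
      rw [Set.uIcc_of_le hr] at hs
      exact (hS.add t s ht hs.1 f).symm
    rw [this, intervalIntegral.integral_comp_add_left (fun s => S s f)]
    simp
  have e2 : ∫ s in (0:ℝ)..t, S s (f - S r f)
      = (∫ s in (0:ℝ)..t, S s f) - ∫ s in r..(r + t), S s f := by
    simp only [map_sub]
    rw [intervalIntegral.integral_sub (hi _ _) ((hS.cont _).intervalIntegrable _ _)]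
    congr 1
    have : ∫ s in (0:ℝ)..t, S s (S r f) = ∫ s in (0:ℝ)..t, S (r + s) f := by
      apply intervalIntegral.integral_congr
      intro s hs
      rw [Set.uIcc_of_le ht] at hs
      simp only
      rw [hS.add r s hr hs.1 f, hS.comm hr hs.1]
    rw [this, intervalIntegral.integral_comp_add_left (fun s => S s f)]
    simp
  rw [e1, e2]
  have a1 := intervalIntegral.integral_add_adjacent_intervals (hi 0 r) (hi r (r + t))
  have a2 := intervalIntegral.integral_add_adjacent_intervals (hi 0 t) (hi t (t + r))
  rw [add_comm t r] at a2 ⊢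
  rw [sub_eq_sub_iff_add_eq_add, a1, a2]

lemma exists_isGen_approx (hS : IsSymmContractionSemigroup S) (f : H) :
    ∃ u v : ℕ → H, (∀ n, IsGen S (u n) (v n)) ∧ Tendsto u atTop (𝓝 f) := by
  have h1 := ((hS.cont f).integral_hasStrictDerivAt 0 0).hasDerivAt.hasDerivWithinAt
    (s := Set.Ioi 0)
  rw [hasDerivWithinAt_iff_tendsto_slope' (by simp), hS.zero] at h1
  let r : ℕ → ℝ := fun n => 1 / ((n:ℝ) + 1)
  have hr : Tendsto r atTop (𝓝[>] 0) := tendsto_nhdsWithin_iff.2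
    ⟨tendsto_one_div_add_atTop_nhds_zero_nat, Eventually.of_forall fun n => by
      simp only [r, Set.mem_Ioi]; positivity⟩
  refine ⟨fun n => (r n)⁻¹ • ∫ s in (0:ℝ)..(r n), S s f, fun n => (r n)⁻¹ • (f - S (r n) f),
    fun n => ?_, ?_⟩
  · have := (hS.isGen_integral f (r := r n) (by simp only [r]; positivity)).const_smul (r n)⁻¹
    refine this.congr fun t => ?_
    simp only [map_smul]
    rw [smul_comm, smul_sub (r n)⁻¹]
  · refine (h1.comp hr).congr fun n => ?_
    simp [slope]

lemma isGen_closed (hS : IsSymmContractionSemigroup S)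
    {f g : H} {u v : ℕ → H} (h : ∀ n, IsGen S (u n) (v n))
    (hu : Tendsto u atTop (𝓝 f)) (hv : Tendsto v atTop (𝓝 g)) : IsGen S f g := by
  apply hS.isGen_of_orbit
  intro t ht
  have h1 : Tendsto (fun n => u n - S t (u n)) atTop (𝓝 (f - S t f)) :=
    hu.sub (((S t).continuous.tendsto f).comp hu)
  have h2 : Tendsto (fun n => ∫ s in (0:ℝ)..t, S s (v n)) atTop
      (𝓝 (∫ s in (0:ℝ)..t, S s g)) := by
    rw [tendsto_iff_norm_sub_tendsto_zero]
    have h3 : Tendsto (fun n => ‖v n - g‖ * |t - 0|) atTop (𝓝 0) := by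
      have := (tendsto_iff_norm_sub_tendsto_zero.1 hv).mul_const |t - 0|
      simpa using this
    refine squeeze_zero (fun _ => norm_nonneg _) (fun n => ?_) h3
    rw [← intervalIntegral.integral_sub ((hS.cont _).intervalIntegrable _ _)
      ((hS.cont _).intervalIntegrable _ _)]
    apply intervalIntegral.norm_integral_le_of_norm_le_const
    intro s _
    rw [← map_sub]; exact hS.contr s _
  refine tendsto_nhds_unique h1 (h2.congr fun n => ?_)
  exact (hS.orbit_eq (h n) ht).symm

lemma hasDerivAt_inner_orbit (hS : IsSymmContractionSemigroup S)
    {f g : H} (h : IsGen S f g) (x : H) {t : ℝ} (ht : 0 < t) :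
    HasDerivAt (fun t => inner ℝ (S t f) x) (-(inner ℝ (S t g) x)) t := by
  have := (hS.hasDerivAt_orbit h ht).inner ℝ (hasDerivAt_const t x)
  simpa using this

/-- The smoothing estimate of an analytic semigroup. -/
lemma norm_gen_le (hS : IsSymmContractionSemigroup S)
    {f g : H} (h : IsGen S f g) {t : ℝ} (ht : 0 < t) : ‖S t g‖ ≤ ‖f‖ / t := by
  -- With `q(s) = ⟨S_s g, g⟩` and `p(s) = ⟨S_s g, f⟩`, both nonnegative and decreasing, one has `p'
  -- = -q` and `⟨S_s f, f⟩' = -p`. The mean value theorem for each gives `t² ‖S_t g‖² = t² q(2t) ≤ t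
  -- p(t) ≤ ‖f‖²`, without the spectral theorem.
  have hq : ∀ a b, 0 ≤ a → a ≤ b → inner ℝ (S b g) g ≤ inner ℝ (S a g) g := by
    intro a b ha hab
    have e1 := hS.inner_eq_norm_sq (t := a / 2) (by linarith) g
    have e2 := hS.inner_eq_norm_sq (t := b / 2) (by linarith) g
    rw [show 2 * (a / 2) = a by ring] at e1
    rw [show 2 * (b / 2) = b by ring] at e2
    rw [e1, e2]
    have : S (b / 2) g = S ((b - a) / 2) (S (a / 2) g) := by
      rw [← hS.add _ _ (by linarith) (by linarith)]; congr 2; ring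
    rw [this]
    gcongr
    exact hS.contr _ _
  have hp : ∀ a b, 0 < a → a < b →
      ∃ c, a < c ∧ c < b ∧ inner ℝ (S a g) f - inner ℝ (S b g) f = (b - a) * inner ℝ (S c g) g := by
    intro a b ha hab
    obtain ⟨c, hc, hc'⟩ := exists_hasDerivAt_eq_slope (fun t => inner ℝ (S t f) g)
      (fun t => -inner ℝ (S t g) g) hab
      ((((hS.cont f).inner continuous_const)).continuousOn)
      (fun x hx => hS.hasDerivAt_inner_orbit h g (ha.trans hx.1))
    refine ⟨c, hc.1, hc.2, ?_⟩
    rw [eq_div_iff (by linarith)] at hc'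
    have e : ∀ s, inner ℝ (S s f) g = inner ℝ (S s g) f := fun s => by
      rw [hS.symm, real_inner_comm]
    simp only [e] at hc'
    linarith
  have hpa : ∀ a b, 0 < a → a < b → inner ℝ (S b g) f ≤ inner ℝ (S a g) f := by
    intro a b ha hab
    obtain ⟨c, h1, h2, h3⟩ := hp a b ha hab
    have := hS.inner_self_nonneg (t := c) (by linarith) g
    nlinarith
  have hpt : t * inner ℝ (S t g) f ≤ ‖f‖ ^ 2 := by
    obtain ⟨c, hc, hc'⟩ := exists_hasDerivAt_eq_slope (fun t => inner ℝ (S t f) f)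
      (fun t => -inner ℝ (S t g) f) ht
      ((((hS.cont f).inner continuous_const)).continuousOn)
      (fun x hx => hS.hasDerivAt_inner_orbit h f hx.1)
    rw [eq_div_iff (by linarith), hS.zero, real_inner_self_eq_norm_sq] at hc'
    have h1 := hpa c t hc.1 hc.2
    have h2 := hS.inner_self_nonneg ht.le f
    nlinarith
  obtain ⟨c, h1, h2, h3⟩ := hp t (2 * t) ht (by linarith)
  have h4 := hq c (2 * t) (by linarith) h2.le
  rw [hS.inner_eq_norm_sq ht.le] at h4
  have h5 : 0 ≤ inner ℝ (S (2 * t) g) f := by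
    have e := hS.isGen_inner_nonneg (hS.isGen_map h ht.le)
    rwa [two_mul, hS.add t t ht.le ht.le, hS.symm]
  rw [le_div_iff₀ ht]
  rw [← sq_le_sq₀ (by positivity) (norm_nonneg f)]
  calc (‖S t g‖ * t) ^ 2 = t * (t * ‖S t g‖ ^ 2) := by ring
    _ ≤ t * (t * inner ℝ (S c g) g) := by gcongr
    _ = t * (inner ℝ (S t g) f - inner ℝ (S (2 * t) g) f) := by rw [h3]; ring
    _ ≤ t * inner ℝ (S t g) f := by gcongr; linarith
    _ ≤ ‖f‖ ^ 2 := hpt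

/-- By the smoothing estimate `A S_t` is bounded on the domain; approximate `f` from the dense
domain and use that `A` is closed. -/
lemma exists_isGen (hS : IsSymmContractionSemigroup S)
    (f : H) {t : ℝ} (ht : 0 < t) : ∃ g, IsGen S (S t f) g := by
  obtain ⟨u, v, huv, hu⟩ := hS.exists_isGen_approx f
  have hc : CauchySeq fun n => S t (v n) := by
    rw [Metric.cauchySeq_iff']
    intro ε hε
    obtain ⟨N, hN⟩ := Metric.cauchySeq_iff'.1 hu.cauchySeq (ε * t) (by positivity)
    refine ⟨N, fun n hn => ?_⟩
    have h1 : IsGen S (u n - u N) (v n - v N) := by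
      refine ((huv n).sub (huv N)).congr fun s => ?_
      rw [← smul_sub, map_sub]; congr 1; abel
    have h2 := hS.norm_gen_le h1 ht
    rw [dist_eq_norm, ← map_sub]
    refine h2.trans_lt ?_
    rw [div_lt_iff₀ ht, ← dist_eq_norm]
    exact hN n hn
  obtain ⟨g, hg⟩ := cauchySeq_tendsto_of_complete hc
  exact ⟨g, hS.isGen_closed (fun n => hS.isGen_map (huv n) ht.le)
    (((S t).continuous.tendsto f).comp hu) hg⟩

/-- A spectral gap yields exponential decay. -/
lemma norm_le_exp_of_gap (hS : IsSymmContractionSemigroup S)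
    {f g : H} (h : IsGen S f g) {σ : ℝ} (hσ : 0 < σ)
    (hgap : ∀ t, 0 ≤ t → σ * ‖S t f‖ ≤ ‖S t g‖) {t : ℝ} (ht : 0 ≤ t) :
    ‖S t f‖ ≤ Real.exp (-(σ * t)) * ‖f‖ := by
  -- Here `k' = -p`, `p' = -q`, and the gap says `q ≥ σ² k`. The aim is the first-order inequality
  -- `p ≥ σ k`.
  let k : ℝ → ℝ := fun t => inner ℝ (S t f) f
  let p : ℝ → ℝ := fun t => inner ℝ (S t g) f
  let q : ℝ → ℝ := fun t => inner ℝ (S t g) g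
  have hk : ∀ s, 0 < s → HasDerivAt k (-p s) s := fun s hs => hS.hasDerivAt_inner_orbit h f hs
  have hp : ∀ s, 0 < s → HasDerivAt p (-q s) s := fun s hs => by
    have := hS.hasDerivAt_inner_orbit h g hs
    refine this.congr_of_eventuallyEq (Eventually.of_forall fun s => ?_)
    simp only [p]; rw [hS.symm, real_inner_comm]
  have hkc : Continuous k := (hS.cont f).inner continuous_const
  have hpc : Continuous p := (hS.cont g).inner continuous_const
  have hqk : ∀ s, 0 ≤ s → σ ^ 2 * k s ≤ q s := by
    intro s hs
    have e1 := hS.inner_eq_norm_sq (t := s / 2) (by linarith) g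
    have e2 := hS.inner_eq_norm_sq (t := s / 2) (by linarith) f
    rw [show 2 * (s / 2) = s by ring] at e1 e2
    simp only [k, q]
    rw [e1, e2, ← mul_pow]
    gcongr
    exact hgap _ (by linarith)
  have hpn : ∀ s, 0 ≤ s → 0 ≤ p s := by
    intro s hs
    have e := hS.isGen_inner_nonneg (hS.isGen_map h (t := s / 2) (by linarith))
    rw [← hS.symm, ← hS.add _ _ (by linarith) (by linarith), add_halves] at e
    exact e
  have hkb : ∀ s, 0 ≤ s → k s ≤ ‖f‖ ^ 2 := by
    intro s hs
    have := (real_inner_le_norm (S s f) f).trans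
      (mul_le_mul_of_nonneg_right (hS.contr s f) (norm_nonneg _))
    simp only [k]; nlinarith
  -- The derivative is `e^{-σ s} (q - σ² k) ≥ 0`. A positive value would therefore persist, whereas
  -- the function is at most `e^{-σ s} σ ‖f‖²`, which tends to `0`.
  have hmono : MonotoneOn (fun s => Real.exp (-(σ * s)) * (σ * k s - p s)) (Set.Ici 0) := by
    have hd : ∀ s, 0 < s → HasDerivAt (fun s => Real.exp (-(σ * s)) * (σ * k s - p s))
        (Real.exp (-(σ * s)) * (-σ) * (σ * k s - p s)
          + Real.exp (-(σ * s)) * (σ * (-p s) - -q s)) s := by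
      intro s hs
      have h1 : HasDerivAt (fun s => -(σ * s)) (-σ) s := by
        simpa using! ((hasDerivAt_id s).const_mul σ).neg
      exact h1.exp.mul (((hk s hs).const_mul σ).sub (hp s hs))
    apply monotoneOn_of_deriv_nonneg (convex_Ici 0)
    · exact (by fun_prop : Continuous _).continuousOn
    · intro s hs
      rw [interior_Ici] at hs
      exact (hd s hs).differentiableAt.differentiableWithinAt
    · intro s hs
      rw [interior_Ici] at hs
      rw [(hd s hs).deriv]
      have h1 := hqk s (le_of_lt hs)
      have h2 := Real.exp_pos (-(σ * s))
      have : Real.exp (-(σ * s)) * (-σ) * (σ * k s - p s)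
          + Real.exp (-(σ * s)) * (σ * (-p s) - -q s)
          = Real.exp (-(σ * s)) * (q s - σ ^ 2 * k s) := by ring
      rw [this]
      exact mul_nonneg h2.le (by linarith)
  have hle : ∀ s, 0 ≤ s → σ * k s - p s ≤ 0 := by
    intro s hs
    by_contra hcon
    push Not at hcon
    have hlim : Tendsto (fun x => Real.exp (-(σ * x)) * (σ * ‖f‖ ^ 2)) atTop (𝓝 0) := by
      have h1 : Tendsto (fun x => σ * x) atTop atTop := tendsto_id.const_mul_atTop hσ
      have := (Real.tendsto_exp_neg_atTop_nhds_zero.comp h1).mul_const (σ * ‖f‖ ^ 2)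
      simpa using this
    have hpos : 0 < Real.exp (-(σ * s)) * (σ * k s - p s) := mul_pos (Real.exp_pos _) hcon
    have : Real.exp (-(σ * s)) * (σ * k s - p s) ≤ 0 := by
      refine ge_of_tendsto hlim ?_
      filter_upwards [eventually_ge_atTop s] with x hx
      refine (hmono (Set.mem_Ici.2 hs) (Set.mem_Ici.2 (hs.trans hx)) hx).trans ?_
      simp only
      have h1 := hkb x (hs.trans hx)
      have h2 := hpn x (hs.trans hx)
      gcongr
      nlinarith
    linarith
  have hanti : AntitoneOn (fun s => Real.exp (σ * s) * k s) (Set.Ici 0) := by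
    have hd : ∀ s, 0 < s → HasDerivAt (fun s => Real.exp (σ * s) * k s)
        (Real.exp (σ * s) * σ * k s + Real.exp (σ * s) * (-p s)) s := by
      intro s hs
      have h1 : HasDerivAt (fun s => σ * s) σ s := by
        simpa using (hasDerivAt_id s).const_mul σ
      exact h1.exp.mul (hk s hs)
    apply antitoneOn_of_deriv_nonpos (convex_Ici 0)
    · exact (by fun_prop : Continuous _).continuousOn
    · intro s hs
      rw [interior_Ici] at hs
      exact (hd s hs).differentiableAt.differentiableWithinAt
    · intro s hs
      rw [interior_Ici] at hs
      rw [(hd s hs).deriv]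
      have h1 := hle s (le_of_lt hs)
      have h2 := Real.exp_pos (σ * s)
      nlinarith
  -- Time `2 t`, because `k(2 t) = ‖S_t f‖²`.
  have h1 := hanti (Set.mem_Ici.2 le_rfl) (Set.mem_Ici.2 (by linarith : 0 ≤ 2 * t))
    (by linarith)
  simp only [mul_zero, Real.exp_zero, one_mul, k, hS.zero, hS.inner_eq_norm_sq ht,
    real_inner_self_eq_norm_sq] at h1
  rw [← sq_le_sq₀ (norm_nonneg _) (by positivity)]
  have e1 : Real.exp (σ * (2 * t)) = Real.exp (σ * t) ^ 2 := by
    rw [← Real.exp_nat_mul]; congr 1; push_cast; ring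
  rw [Real.exp_neg, inv_mul_eq_div, div_pow, le_div_iff₀ (by positivity), ← e1]
  linarith

end IsSymmContractionSemigroup

end HilbertSemigroup

variable {Ω : Type*} [MeasurableSpace Ω] {μ : Measure Ω}

/-! ### The algebra `L_∞` -/

section LinfAlgebra

lemma coeFn_mulLinf (f g : Linf μ) : ⇑(mulLinf f g) =ᵐ[μ] fun x => f x * g x :=
  MemLp.coeFn_toLp _

variable [IsFiniteMeasure μ]

/-- The pointwise product makes `L_∞` a commutative ring. -/
scoped instance instCommRingLinf : CommRing (Linf μ) :=
  { (inferInstance : AddCommGroup (Linf μ)) with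
    mul := mulLinf
    one := Lp.const ∞ μ (1 : ℝ)
    mul_assoc := fun f g h => Lp.ext <| by
      filter_upwards [coeFn_mulLinf (mulLinf f g) h, coeFn_mulLinf f g,
        coeFn_mulLinf f (mulLinf g h), coeFn_mulLinf g h] with x h1 h2 h3 h4
      refine h1.trans (Eq.trans ?_ h3.symm)
      rw [h2, h4]; ring
    one_mul := fun f => Lp.ext <| by
      filter_upwards [coeFn_mulLinf (Lp.const ∞ μ (1 : ℝ)) f, Lp.coeFn_const ∞ μ (1 : ℝ)]
        with x h1 h2
      exact h1.trans (by rw [h2]; simp)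
    mul_one := fun f => Lp.ext <| by
      filter_upwards [coeFn_mulLinf f (Lp.const ∞ μ (1 : ℝ)), Lp.coeFn_const ∞ μ (1 : ℝ)]
        with x h1 h2
      exact h1.trans (by rw [h2]; simp)
    left_distrib := fun f g h => Lp.ext <| by
      filter_upwards [coeFn_mulLinf f (g + h), coeFn_mulLinf f g, coeFn_mulLinf f h,
        Lp.coeFn_add g h, Lp.coeFn_add (mulLinf f g) (mulLinf f h)] with x h1 h2 h3 h4 h5
      refine h1.trans (Eq.trans ?_ h5.symm)
      rw [Pi.add_apply, h4, Pi.add_apply, h2, h3]; ring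
    right_distrib := fun f g h => Lp.ext <| by
      filter_upwards [coeFn_mulLinf (f + g) h, coeFn_mulLinf f h, coeFn_mulLinf g h,
        Lp.coeFn_add f g, Lp.coeFn_add (mulLinf f h) (mulLinf g h)] with x h1 h2 h3 h4 h5
      refine h1.trans (Eq.trans ?_ h5.symm)
      rw [Pi.add_apply, h4, Pi.add_apply, h2, h3]; ring
    zero_mul := fun f => Lp.ext <| by
      filter_upwards [coeFn_mulLinf 0 f, Lp.coeFn_zero ℝ ∞ μ] with x h1 h2
      exact h1.trans (by rw [h2]; simp)
    mul_zero := fun f => Lp.ext <| by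
      filter_upwards [coeFn_mulLinf f 0, Lp.coeFn_zero ℝ ∞ μ] with x h1 h2
      exact h1.trans (by rw [h2]; simp)
    mul_comm := fun f g => Lp.ext <| by
      filter_upwards [coeFn_mulLinf f g, coeFn_mulLinf g f] with x h1 h2
      exact h1.trans ((mul_comm _ _).trans h2.symm) }

lemma coeFn_mul (f g : Linf μ) : ⇑(f * g) =ᵐ[μ] fun x => f x * g x := coeFn_mulLinf f g

lemma coeFn_one : ⇑(1 : Linf μ) =ᵐ[μ] fun _ => (1 : ℝ) := Lp.coeFn_const ∞ μ (1 : ℝ)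

lemma coeFn_smul_one (a : ℝ) : ⇑(a • (1 : Linf μ)) =ᵐ[μ] fun _ => a := by
  filter_upwards [Lp.coeFn_smul a (1 : Linf μ), coeFn_one (μ := μ)] with x h1 h2
  simp [h1, h2]

scoped instance instAlgebraLinf : Algebra ℝ (Linf μ) :=
  Algebra.ofModule
    (fun r f g => Lp.ext <| by
      filter_upwards [coeFn_mul (r • f) g, coeFn_mul f g, Lp.coeFn_smul r f,
        Lp.coeFn_smul r (f * g)] with x h1 h2 h3 h4
      rw [h1, h3, h4]; simp [h2, mul_assoc])
    (fun r f g => Lp.ext <| by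
      filter_upwards [coeFn_mul f (r • g), coeFn_mul f g, Lp.coeFn_smul r g,
        Lp.coeFn_smul r (f * g)] with x h1 h2 h3 h4
      rw [h1, h3, h4]; simp [h2, mul_left_comm])

lemma coeFn_pow (f : Linf μ) (n : ℕ) : ⇑(f ^ n) =ᵐ[μ] fun x => f x ^ n := by
  induction n with
  | zero => simpa using coeFn_one
  | succ n ih =>
    rw [pow_succ]
    filter_upwards [coeFn_mul (f ^ n) f, ih] with x h1 h2
    rw [h1, h2, pow_succ]

/-- Multiplication of `L_∞` as a continuous bilinear map. -/
def mulL (μ : Measure Ω) : Linf μ →L[ℝ] Linf μ →L[ℝ] Linf μ :=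
  (ContinuousLinearMap.mul ℝ ℝ).holderL μ ∞ ∞ ∞

lemma _root_.HasDerivAt.linf_mul {f g : ℝ → Linf μ} {f' g' : Linf μ} {t : ℝ}
    (hf : HasDerivAt f f' t) (hg : HasDerivAt g g' t) :
    HasDerivAt (fun s => f s * g s) (f t * g' + f' * g t) t :=
  (mulL μ).hasDerivAt_of_bilinear (fun _ => hf) (fun _ => hg)

lemma linf_nonneg_iff {f : Linf μ} : 0 ≤ f ↔ ∀ᵐ x ∂μ, 0 ≤ f x := by
  rw [← Lp.coeFn_nonneg]; rfl

lemma linf_mul_nonneg {f g : Linf μ} (hf : 0 ≤ f) (hg : 0 ≤ g) : 0 ≤ f * g := by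
  rw [linf_nonneg_iff] at *
  filter_upwards [hf, hg, coeFn_mul f g] with x h1 h2 h3
  rw [h3]; positivity

lemma linf_mul_self_nonneg (f : Linf μ) : 0 ≤ f * f := by
  rw [linf_nonneg_iff]
  filter_upwards [coeFn_mul f f] with x h
  rw [h]; exact mul_self_nonneg _

lemma linf_one_nonneg : (0 : Linf μ) ≤ 1 := by
  rw [linf_nonneg_iff]
  filter_upwards [coeFn_one (μ := μ)] with x h
  rw [h]; norm_num

lemma linf_ae_abs_le (f : Linf μ) : ∀ᵐ x ∂μ, |f x| ≤ ‖f‖ := by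
  have h := ae_le_eLpNormEssSup (f := f) (μ := μ)
  have h2 : ‖f‖ = (eLpNormEssSup f μ).toReal := by
    rw [Lp.norm_def, eLpNorm_exponent_top]
  have h3 : eLpNormEssSup f μ ≠ ∞ := by
    rw [← eLpNorm_exponent_top]; exact (Lp.memLp f).2.ne
  filter_upwards [h] with x hx
  rw [h2, ← Real.norm_eq_abs, ← toReal_enorm]
  exact ENNReal.toReal_mono h3 hx

lemma linf_le_norm_smul_one (f : Linf μ) : f ≤ ‖f‖ • (1 : Linf μ) := by
  rw [← Lp.coeFn_le]
  filter_upwards [linf_ae_abs_le f, coeFn_smul_one (μ := μ) ‖f‖] with x h1 h2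
  rw [h2]; exact (le_abs_self _).trans h1

lemma linf_integrable (f : Linf μ) : Integrable f μ :=
  memLp_one_iff_integrable.1 ((Lp.memLp f).mono_exponent le_top)

lemma linf_mul_integrable (f : Linf μ) {γ : Ω → ℝ} (hγ : Integrable γ μ) :
    Integrable (fun x => f x * γ x) μ :=
  hγ.bdd_mul (Lp.memLp f).1 (by
    filter_upwards [linf_ae_abs_le f] with x hx using hx)

/-- Build a bounded function from an almost everywhere bounded measurable one. -/
lemma exists_linf {u : Ω → ℝ} (hu : AEStronglyMeasurable u μ) {C : ℝ}
    (hC : ∀ᵐ x ∂μ, |u x| ≤ C) : ∃ f : Linf μ, ⇑f =ᵐ[μ] u :=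
  ⟨(memLp_top_of_bound hu C hC).toLp u, MemLp.coeFn_toLp _⟩

end LinfAlgebra

/-! ### Expectation, and the embedding of `L_∞` in `L_2` -/

section Expect

variable [IsProbabilityMeasure μ]

/-- Pairing of bounded functions with an integrable function. -/
def pairing (μ : Measure Ω) [IsProbabilityMeasure μ] (γ : Lp ℝ 1 μ) : Linf μ →L[ℝ] ℝ :=
  ((ContinuousLinearMap.mul ℝ ℝ).lpPairing μ ∞ 1).flip γ

lemma pairing_apply (γ : Lp ℝ 1 μ) (f : Linf μ) : pairing μ γ f = ∫ x, f x * γ x ∂μ :=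
  ContinuousLinearMap.lpPairing_eq_integral _ _ _

/-- The expectation functional on bounded functions. -/
def expect (μ : Measure Ω) [IsProbabilityMeasure μ] : Linf μ →L[ℝ] ℝ :=
  pairing μ (Lp.const 1 μ (1 : ℝ))

lemma expect_apply (f : Linf μ) : expect μ f = ∫ x, f x ∂μ := by
  rw [expect, pairing_apply]
  apply integral_congr_ae
  filter_upwards [Lp.coeFn_const 1 μ (1 : ℝ)] with x h
  rw [h]; simp

lemma expect_mul (f g : Linf μ) : expect μ (f * g) = ∫ x, f x * g x ∂μ := by
  rw [expect_apply]; exact integral_congr_ae (coeFn_mul f g)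

lemma expect_one : expect μ 1 = 1 := by
  rw [expect_apply, integral_congr_ae coeFn_one]; simp

lemma expect_nonneg {f : Linf μ} (hf : 0 ≤ f) : 0 ≤ expect μ f := by
  rw [expect_apply]; exact integral_nonneg_of_ae (linf_nonneg_iff.1 hf)

lemma expect_mono {f g : Linf μ} (h : f ≤ g) : expect μ f ≤ expect μ g := by
  have := expect_nonneg (sub_nonneg.2 h)
  rw [map_sub] at this; linarith

/-- The inclusion of `L_∞` in `L_2`. -/
def toL2 (μ : Measure Ω) [IsProbabilityMeasure μ] : Linf μ →L[ℝ] Lp ℝ 2 μ :=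
  ((ContinuousLinearMap.mul ℝ ℝ).holderL μ ∞ 2 2).flip (Lp.const 2 μ (1 : ℝ))

lemma coeFn_toL2 (f : Linf μ) : ⇑(toL2 μ f) =ᵐ[μ] f := by
  filter_upwards [ContinuousLinearMap.coeFn_holder (r := 2) (ContinuousLinearMap.mul ℝ ℝ) f
    (Lp.const 2 μ (1 : ℝ)), Lp.coeFn_const 2 μ (1 : ℝ)] with x h1 h2
  refine Eq.trans h1 ?_
  rw [h2]; simp

lemma inner_toL2_left (f : Linf μ) (g : Lp ℝ 2 μ) : inner ℝ (toL2 μ f) g = ∫ x, f x * g x ∂μ := by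
  rw [L2.inner_def]
  apply integral_congr_ae
  filter_upwards [coeFn_toL2 f] with x h
  rw [h]; simp [mul_comm]

lemma inner_toL2 (f g : Linf μ) : inner ℝ (toL2 μ f) (toL2 μ g) = expect μ (f * g) := by
  rw [inner_toL2_left, expect_mul]
  apply integral_congr_ae
  filter_upwards [coeFn_toL2 g] with x h
  rw [h]

lemma norm_toL2_sq (f : Linf μ) : ‖toL2 μ f‖ ^ 2 = expect μ (f * f) := by
  rw [← inner_toL2, real_inner_self_eq_norm_sq]

lemma denseRange_toL2 : DenseRange (toL2 μ) := by
  have h := Lp.simpleFunc.denseRange (E := ℝ) (μ := μ) (p := 2) (by norm_num)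
  refine Dense.mono ?_ h
  rintro _ ⟨s, rfl⟩
  let u := Lp.simpleFunc.toSimpleFunc s
  refine ⟨(u.memLp_top μ).toLp u, ?_⟩
  apply Lp.ext
  filter_upwards [coeFn_toL2 ((u.memLp_top μ).toLp u), MemLp.coeFn_toLp (u.memLp_top μ),
    Lp.simpleFunc.toSimpleFunc_eq_toFun s] with x h1 h2 h3
  rw [h1, h2, ← h3]

lemma toL2_injective : Function.Injective (toL2 μ) := by
  intro f g h
  apply Lp.ext
  filter_upwards [coeFn_toL2 f, coeFn_toL2 g] with x h1 h2
  rw [← h1, ← h2, h]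

lemma expect_abs_le_norm_toL2 (f : Linf μ) : ∫ x, |f x| ∂μ ≤ ‖toL2 μ f‖ := by
  have h1 : (∫ x, |f x| ∂μ) = (eLpNorm (toL2 μ f) 1 μ).toReal := by
    rw [eLpNorm_congr_ae (coeFn_toL2 f), eLpNorm_one_eq_lintegral_enorm,
      ← integral_norm_eq_lintegral_enorm (Lp.memLp f).1]
    rfl
  rw [h1, Lp.norm_def]
  apply ENNReal.toReal_mono (Lp.memLp (toL2 μ f)).2.ne
  exact eLpNorm_le_eLpNorm_of_exponent_le (by norm_num) (Lp.memLp (toL2 μ f)).1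

/-- Inequalities depending continuously on a real parameter hold simultaneously almost
everywhere. -/
lemma ae_forall_nonneg {Q : Ω → ℝ → ℝ} (hc : ∀ x, Continuous (Q x))
    (h : ∀ a, ∀ᵐ x ∂μ, 0 ≤ Q x a) : ∀ᵐ x ∂μ, ∀ a, 0 ≤ Q x a := by
  have h1 : ∀ᵐ x ∂μ, ∀ q : ℚ, 0 ≤ Q x (q : ℝ) := ae_all_iff.2 fun q => h q
  filter_upwards [h1] with x hx a
  exact Rat.isDenseEmbedding_coe_real.dense.induction_on (p := fun a => 0 ≤ Q x a) a
    (isClosed_le continuous_const (hc x)) hx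

end Expect

variable [IsProbabilityMeasure μ]

/-! ### Extension to `L_2` and differentiability of orbits in `L_∞` -/

section L2Semigroup

variable {T : ℝ → Linf μ →L[ℝ] Linf μ}

lemma IsMarkovSemigroup.map_one (hT : IsMarkovSemigroup T) {t : ℝ} (ht : 0 ≤ t) : T t 1 = 1 :=
  hT.unital t ht

lemma IsMarkovSemigroup.zero_apply (hT : IsMarkovSemigroup T) (f : Linf μ) : T 0 f = f := by
  rw [hT.zero]; rfl

lemma IsMarkovSemigroup.add_apply (hT : IsMarkovSemigroup T) {s t : ℝ} (hs : 0 ≤ s) (ht : 0 ≤ t)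
    (f : Linf μ) : T (s + t) f = T s (T t f) := by
  rw [hT.add s t hs ht]; rfl

lemma IsMarkovSemigroup.mono (hT : IsMarkovSemigroup T) {t : ℝ} (ht : 0 ≤ t) {f g : Linf μ}
    (h : f ≤ g) : T t f ≤ T t g := by
  have := hT.nonneg t ht _ (sub_nonneg.2 h)
  rwa [map_sub, sub_nonneg] at this

lemma IsSymmetricSemigroup.expect_symm (hs : IsSymmetricSemigroup T) {t : ℝ} (ht : 0 ≤ t)
    (f g : Linf μ) : expect μ (f * T t g) = expect μ (T t f * g) := by
  rw [expect_mul, expect_mul]; exact hs t ht f g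

lemma expect_map (hT : IsMarkovSemigroup T) (hs : IsSymmetricSemigroup T) {t : ℝ} (ht : 0 ≤ t)
    (f : Linf μ) : expect μ (T t f) = expect μ f := by
  have := hs.expect_symm ht 1 f
  rwa [hT.map_one ht, one_mul, one_mul] at this

/-- A positive unital map satisfies `2 a P f ≤ P (f²) + a²`, simultaneously for all `a`. -/
lemma ae_forall_sq_nonneg {P : Linf μ →L[ℝ] Linf μ} (hP : ∀ f, 0 ≤ f → 0 ≤ P f) (h1 : P 1 = 1)
    (f : Linf μ) : ∀ᵐ x ∂μ, ∀ a : ℝ, 0 ≤ P (f * f) x - 2 * a * P f x + a ^ 2 := by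
  apply ae_forall_nonneg (fun x => by fun_prop)
  intro a
  have h := hP _ (linf_mul_self_nonneg (f - a • (1 : Linf μ)))
  have e : (f - a • (1 : Linf μ)) * (f - a • (1 : Linf μ))
      = f * f - (2 * a) • f + (a ^ 2) • (1 : Linf μ) := by
    simp only [sub_mul, mul_sub, smul_mul_assoc, mul_smul_comm, one_mul, mul_one]; module
  rw [e, map_add, map_sub, map_smul, map_smul, h1, linf_nonneg_iff] at h
  filter_upwards [h, Lp.coeFn_add (P (f * f) - (2 * a) • P f) ((a ^ 2) • (1 : Linf μ)),
    Lp.coeFn_sub (P (f * f)) ((2 * a) • P f), Lp.coeFn_smul (2 * a) (P f),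
    coeFn_smul_one (μ := μ) (a ^ 2)] with x h0 h1 h2 h3 h4
  rw [h1, Pi.add_apply, h2, Pi.sub_apply, h3, h4] at h0
  simpa using h0

/-- The choice `a = T_t f(x)` in `ae_forall_sq_nonneg` gives `(T_t f)² ≤ T_t (f²)`; then integrate,
using that `T_t` preserves the expectation. -/
lemma expect_map_mul_map_le (hT : IsMarkovSemigroup T) (hs : IsSymmetricSemigroup T) {t : ℝ}
    (ht : 0 ≤ t) (f : Linf μ) : expect μ (T t f * T t f) ≤ expect μ (f * f) := by
  rw [← expect_map hT hs ht (f * f)]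
  apply expect_mono
  rw [← Lp.coeFn_le]
  filter_upwards [ae_forall_sq_nonneg (hT.nonneg t ht) (hT.map_one ht) f,
    coeFn_mul (T t f) (T t f)] with x h1 h2
  have := h1 (T t f x)
  rw [h2]; nlinarith

lemma norm_toL2_map_le (hT : IsMarkovSemigroup T) (hs : IsSymmetricSemigroup T) {t : ℝ}
    (ht : 0 ≤ t) (f : Linf μ) : ‖toL2 μ (T t f)‖ ≤ ‖toL2 μ f‖ := by
  rw [← sq_le_sq₀ (norm_nonneg _) (norm_nonneg _), norm_toL2_sq, norm_toL2_sq]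
  exact expect_map_mul_map_le hT hs ht f

/-- The extension of the semigroup to `L_2`. -/
def l2Semigroup (T : ℝ → Linf μ →L[ℝ] Linf μ) (t : ℝ) : Lp ℝ 2 μ →L[ℝ] Lp ℝ 2 μ :=
  LinearMap.extendOfNorm ((toL2 μ ∘L T (max t 0)) : Linf μ →ₗ[ℝ] Lp ℝ 2 μ)
    (toL2 μ : Linf μ →ₗ[ℝ] Lp ℝ 2 μ)

lemma l2Semigroup_toL2 (hT : IsMarkovSemigroup T) (hs : IsSymmetricSemigroup T) (t : ℝ)
    (f : Linf μ) : l2Semigroup T t (toL2 μ f) = toL2 μ (T (max t 0) f) :=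
  LinearMap.extendOfNorm_eq (f := ((toL2 μ ∘L T (max t 0)) : Linf μ →ₗ[ℝ] Lp ℝ 2 μ))
    (e := (toL2 μ : Linf μ →ₗ[ℝ] Lp ℝ 2 μ)) denseRange_toL2
    ⟨1, fun x => by rw [one_mul]; exact norm_toL2_map_le hT hs (le_max_right _ _) x⟩ f

lemma l2Semigroup_toL2_of_nonneg (hT : IsMarkovSemigroup T) (hs : IsSymmetricSemigroup T) {t : ℝ}
    (ht : 0 ≤ t) (f : Linf μ) : l2Semigroup T t (toL2 μ f) = toL2 μ (T t f) := by
  rw [l2Semigroup_toL2 hT hs, max_eq_left ht]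

/-- Weak continuity upgrades to strong by symmetry: with `k(r) = ⟨f, T_r f⟩` one has `‖T_s f - T_t
f‖₂² = k(2s) - 2 k(s + t) + k(2t)`. -/
lemma continuous_toL2_map (hT : IsMarkovSemigroup T) (hs : IsSymmetricSemigroup T) (f : Linf μ) :
    Continuous fun t => toL2 μ (T (max t 0) f) := by
  have hk : ContinuousOn (fun t => expect μ (f * T t f)) (Set.Ici 0) := by
    simp only [expect_mul]
    exact hT.ultraweak_continuous f f (linf_integrable f)
  have hk' : Continuous fun t : ℝ => expect μ (f * T (max t 0) f) := by
    have := hk.comp_continuous (f := fun t : ℝ => max t 0) (by fun_prop)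
      (fun t => le_max_right t 0)
    exact this
  set k : ℝ → ℝ := fun t => expect μ (f * T (max t 0) f) with hkdef
  have hin : ∀ a b : ℝ, 0 ≤ a → 0 ≤ b →
      inner ℝ (toL2 μ (T a f)) (toL2 μ (T b f)) = k (a + b) := by
    intro a b ha hb
    rw [inner_toL2, hkdef]
    simp only [max_eq_left (add_nonneg ha hb)]
    rw [hT.add_apply ha hb, hs.expect_symm ha]
  rw [continuous_iff_continuousAt]
  intro t
  rw [ContinuousAt, tendsto_iff_norm_sub_tendsto_zero]
  have h1 : ∀ s, ‖toL2 μ (T (max s 0) f) - toL2 μ (T (max t 0) f)‖ ^ 2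
      = k (max s 0 + max s 0) - 2 * k (max s 0 + max t 0) + k (max t 0 + max t 0) := by
    intro s
    rw [norm_sub_sq_real, ← real_inner_self_eq_norm_sq, ← real_inner_self_eq_norm_sq,
      hin _ _ (le_max_right _ _) (le_max_right _ _), hin _ _ (le_max_right _ _) (le_max_right _ _),
      hin _ _ (le_max_right _ _) (le_max_right _ _)]
  have h2 : Tendsto (fun s => ‖toL2 μ (T (max s 0) f) - toL2 μ (T (max t 0) f)‖ ^ 2)
      (𝓝 t) (𝓝 0) := by
    have hc : Continuous fun s : ℝ => k (max s 0 + max s 0) - 2 * k (max s 0 + max t 0)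
      + k (max t 0 + max t 0) := by fun_prop
    have := hc.tendsto t
    simp only [h1]
    convert this using 2
    ring
  have h3 := h2.sqrt
  simpa [Real.sqrt_sq (norm_nonneg _)] using h3

lemma isSymmContractionSemigroup (hT : IsMarkovSemigroup T) (hs : IsSymmetricSemigroup T) :
    IsSymmContractionSemigroup (l2Semigroup T) where
  zero := fun f => by
    refine denseRange_toL2.induction_on (p := fun f => l2Semigroup T 0 f = f) f
      (isClosed_eq (by fun_prop) (by fun_prop)) fun g => ?_
    rw [l2Semigroup_toL2_of_nonneg hT hs le_rfl, hT.zero_apply]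
  add := fun s t h1 h2 f => by
    refine denseRange_toL2.induction_on
      (p := fun f => l2Semigroup T (s + t) f = l2Semigroup T s (l2Semigroup T t f)) f
      (isClosed_eq (by fun_prop) (by fun_prop)) fun g => ?_
    rw [l2Semigroup_toL2_of_nonneg hT hs h2, l2Semigroup_toL2_of_nonneg hT hs h1,
      l2Semigroup_toL2_of_nonneg hT hs (add_nonneg h1 h2), hT.add_apply h1 h2]
  symm := fun t f g => by
    refine denseRange_toL2.induction_on₂
      (p := fun f g => inner ℝ (l2Semigroup T t f) g = inner ℝ f (l2Semigroup T t g))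
      (isClosed_eq (by fun_prop) (by fun_prop)) (fun u v => ?_) f g
    rw [l2Semigroup_toL2 hT hs, l2Semigroup_toL2 hT hs, inner_toL2, inner_toL2,
      hs.expect_symm (le_max_right _ _)]
  contr := fun t f => by
    refine denseRange_toL2.induction_on (p := fun f => ‖l2Semigroup T t f‖ ≤ ‖f‖) f
      (isClosed_le (by fun_prop) (by fun_prop)) fun g => ?_
    rw [l2Semigroup_toL2 hT hs]
    exact norm_toL2_map_le hT hs (le_max_right _ _) g
  cont := fun f => by
    apply continuous_of_uniform_approx_of_continuous
    intro u hu
    obtain ⟨ε, hε, hu'⟩ := Metric.mem_uniformity_dist.1 hu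
    obtain ⟨g, hg⟩ := denseRange_toL2.exists_dist_lt f hε
    refine ⟨fun t => toL2 μ (T (max t 0) g), continuous_toL2_map hT hs g, fun t => hu' ?_⟩
    simp only
    rw [← l2Semigroup_toL2 hT hs, dist_eq_norm, ← map_sub]
    have h1 : ‖l2Semigroup T t (f - toL2 μ g)‖ ≤ ‖f - toL2 μ g‖ := by
      have := LinearMap.norm_extendOfNorm_apply_le
        (f := ((toL2 μ ∘L T (max t 0)) : Linf μ →ₗ[ℝ] Lp ℝ 2 μ))
        (e := (toL2 μ : Linf μ →ₗ[ℝ] Lp ℝ 2 μ)) denseRange_toL2 1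
        (fun x => by rw [one_mul]; exact norm_toL2_map_le hT hs (le_max_right _ _) x)
        (f - toL2 μ g)
      rwa [one_mul] at this
    exact h1.trans_lt (by rwa [← dist_eq_norm])

lemma hasGenerator_iff (hT : IsMarkovSemigroup T) (hs : IsSymmetricSemigroup T) {f : Linf μ}
    {g : Lp ℝ 2 μ} : HasGenerator T f g ↔ IsGen (l2Semigroup T) (toL2 μ f) g := by
  rw [HasGenerator, and_iff_right (Lp.memLp g), IsGen, Lp.tendsto_Lp_iff_tendsto_eLpNorm']
  apply tendsto_congr'
  filter_upwards [self_mem_nhdsWithin] with t ht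
  apply eLpNorm_congr_ae
  rw [l2Semigroup_toL2_of_nonneg hT hs (le_of_lt ht), ← map_sub, ← map_smul]
  filter_upwards [coeFn_toL2 (t⁻¹ • (f - T t f)), Lp.coeFn_smul t⁻¹ (f - T t f),
    Lp.coeFn_sub f (T t f)] with x h1 h2 h3
  rw [Pi.sub_apply, h1, h2, Pi.smul_apply, h3, Pi.sub_apply, smul_eq_mul]
  ring

lemma HasGenerator.congr {f : Linf μ} {g h : Ω → ℝ} (hg : HasGenerator T f g) (hgh : g =ᵐ[μ] h) :
    HasGenerator T f h := by
  refine ⟨(memLp_congr_ae hgh).1 hg.1, hg.2.congr fun t => eLpNorm_congr_ae ?_⟩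
  filter_upwards [hgh] with x hx
  rw [hx]

lemma hasGenerator_iff_toLp (hT : IsMarkovSemigroup T) (hs : IsSymmetricSemigroup T) {f : Linf μ}
    {g : Ω → ℝ} (hg : MemLp g 2 μ) :
    HasGenerator T f g ↔ IsGen (l2Semigroup T) (toL2 μ f) (hg.toLp g) := by
  rw [← hasGenerator_iff hT hs]
  exact ⟨fun h => h.congr hg.coeFn_toLp.symm, fun h => h.congr hg.coeFn_toLp⟩

lemma hasGenerator_iff_toL2 (hT : IsMarkovSemigroup T) (hs : IsSymmetricSemigroup T)
    {f g : Linf μ} : HasGenerator T f g ↔ IsGen (l2Semigroup T) (toL2 μ f) (toL2 μ g) := by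
  rw [← hasGenerator_iff hT hs]
  exact ⟨fun h => h.congr (coeFn_toL2 g).symm, fun h => h.congr (coeFn_toL2 g)⟩

lemma HasGenerator.tendsto_expect (hT : IsMarkovSemigroup T) (hs : IsSymmetricSemigroup T)
    {f : Linf μ} {g : Ω → ℝ} (h : HasGenerator T f g) (w : Linf μ) :
    Tendsto (fun t : ℝ => t⁻¹ * expect μ (w * (f - T t f))) (𝓝[>] 0) (𝓝 (∫ x, w x * g x ∂μ)) := by
  have h1 := (hasGenerator_iff_toLp hT hs h.1).1 h
  have h2 := Tendsto.inner (𝕜 := ℝ) (tendsto_const_nhds (x := toL2 μ w)) h1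
  have e : inner ℝ (toL2 μ w) (h.1.toLp g) = ∫ x, w x * g x ∂μ := by
    rw [inner_toL2_left]
    apply integral_congr_ae
    filter_upwards [h.1.coeFn_toLp] with x hx
    rw [hx]
  rw [e] at h2
  refine h2.congr' ?_
  filter_upwards [self_mem_nhdsWithin] with t ht
  rw [l2Semigroup_toL2_of_nonneg hT hs (le_of_lt ht), ← map_sub, real_inner_smul_right, inner_toL2]

/-- On a probability space the `L_1` norm is at most the `L_2` norm, so ultracontractivity extends
`T_t` by density. -/
lemma exists_l2_to_linf {c d : ℝ} (hV : VaropoulosBound T c d) (hc : 0 < c) {t : ℝ} (h0 : 0 < t)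
    (h1 : t < 1) : ∃ U : Lp ℝ 2 μ →L[ℝ] Linf μ, ∀ f, U (toL2 μ f) = T t f :=
  ⟨LinearMap.extendOfNorm (T t : Linf μ →ₗ[ℝ] Linf μ) (toL2 μ : Linf μ →ₗ[ℝ] Lp ℝ 2 μ),
    LinearMap.extendOfNorm_eq (f := (T t : Linf μ →ₗ[ℝ] Linf μ))
      (e := (toL2 μ : Linf μ →ₗ[ℝ] Lp ℝ 2 μ)) denseRange_toL2 ⟨c * t ^ (-(d / 2)), fun f => by
        refine (hV t h0 h1 f).trans ?_
        have : 0 ≤ c * t ^ (-(d / 2)) := by positivity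
        exact mul_le_mul_of_nonneg_left (expect_abs_le_norm_toL2 f) this⟩⟩

/-- The `L_∞`-valued orbit is differentiable at positive times, with the generator as
derivative. -/
lemma exists_hasDerivAt_hasGenerator (hT : IsMarkovSemigroup T) (hs : IsSymmetricSemigroup T)
    {c d : ℝ} (hV : VaropoulosBound T c d) (hc : 0 < c) (f : Linf μ) {t : ℝ} (ht : 0 < t) :
    ∃ g : Linf μ, HasDerivAt (fun s => T s f) (-g) t ∧ HasGenerator T (T t f) g := by
  have hS := isSymmContractionSemigroup hT hs
  -- Factor `T_s = U S_{s-2r} S_r` for `s` near `t`: `S_r` maps into the domain, the middle factor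
  -- is differentiated in `L_2` at a positive time, and `U`, the extension of `T_r`, carries the
  -- derivative to `L_∞`.
  obtain ⟨r, hr0, hr1, hrt⟩ : ∃ r : ℝ, 0 < r ∧ r < 1 ∧ 2 * r < t :=
    ⟨min (t / 4) (1 / 2), by positivity, (min_le_right _ _).trans_lt (by norm_num),
      by linarith [min_le_left (t / 4) (1 / 2)]⟩
  obtain ⟨U, hU⟩ := exists_l2_to_linf hV hc hr0 hr1
  have hU' : ∀ x, toL2 μ (U x) = l2Semigroup T r x := fun x => by
    refine denseRange_toL2.induction_on (p := fun x => toL2 μ (U x) = l2Semigroup T r x) x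
      (isClosed_eq (by fun_prop) (by fun_prop)) fun g => ?_
    rw [hU, l2Semigroup_toL2_of_nonneg hT hs hr0.le]
  obtain ⟨g0, hg0⟩ := hS.exists_isGen (toL2 μ f) hr0
  refine ⟨U (l2Semigroup T (t - 2 * r) g0), ?_, ?_⟩
  · have h1 : HasDerivAt (fun s : ℝ => s - 2 * r) 1 t := (hasDerivAt_id t).sub_const _
    have h2 := (hS.hasDerivAt_orbit hg0 (t := t - 2 * r) (by linarith)).scomp t h1
    have h3 := U.hasFDerivAt.comp_hasDerivAt t h2
    rw [one_smul, map_neg] at h3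
    refine h3.congr_of_eventuallyEq ?_
    filter_upwards [lt_mem_nhds hrt] with s hs'
    simp only [Function.comp]
    rw [l2Semigroup_toL2_of_nonneg hT hs hr0.le,
      l2Semigroup_toL2_of_nonneg hT hs (by linarith), hU,
      ← hT.add_apply (by linarith) hr0.le, ← hT.add_apply hr0.le (by linarith),
      show r + (s - 2 * r + r) = s by ring]
  · rw [hasGenerator_iff_toL2 hT hs, hU']
    have h1 := hS.isGen_map (hS.isGen_map hg0 (t := t - 2 * r) (by linarith)) hr0.le
    convert h1 using 1
    rw [← hS.add _ _ (by linarith) hr0.le, ← hS.add _ _ hr0.le (by linarith),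
      l2Semigroup_toL2_of_nonneg hT hs (by linarith),
      show r + (t - 2 * r + r) = t by ring]

lemma HasGenerator.unique {f g h : Linf μ} (hT : IsMarkovSemigroup T)
    (hs : IsSymmetricSemigroup T) (hg : HasGenerator T f g)
    (hh : HasGenerator T f h) : g = h := by
  rw [hasGenerator_iff_toL2 hT hs] at hg hh
  exact toL2_injective (tendsto_nhds_unique hg hh)

lemma HasGenerator.map_linf {f g : Linf μ} (hT : IsMarkovSemigroup T)
    (hs : IsSymmetricSemigroup T) (hg : HasGenerator T f g) {t : ℝ} (ht : 0 ≤ t) :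
    HasGenerator T (T t f) (T t g) := by
  rw [hasGenerator_iff_toL2 hT hs] at hg ⊢
  have := (isSymmContractionSemigroup hT hs).isGen_map hg ht
  rwa [l2Semigroup_toL2_of_nonneg hT hs ht, l2Semigroup_toL2_of_nonneg hT hs ht] at this

end L2Semigroup

/-! ### The gradient form and its weak calculus -/

section GradientForm

variable {T : ℝ → Linf μ →L[ℝ] Linf μ}

/-- The gradient form of `(id - T_t) / t`, as a bounded function. -/
def gammaT (T : ℝ → Linf μ →L[ℝ] Linf μ) (t : ℝ) (f g : Linf μ) : Linf μ :=
  (2 * t)⁻¹ • (T t (f * g) - f * T t g - T t f * g + f * g)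

lemma approxGamma_ae_eq (t : ℝ) (f g : Linf μ) : approxGamma T t f g =ᵐ[μ] gammaT T t f g := by
  filter_upwards [Lp.coeFn_smul (2 * t)⁻¹ (T t (f * g) - f * T t g - T t f * g + f * g),
    Lp.coeFn_add (T t (f * g) - f * T t g - T t f * g) (f * g),
    Lp.coeFn_sub (T t (f * g) - f * T t g) (T t f * g),
    Lp.coeFn_sub (T t (f * g)) (f * T t g), coeFn_mul f (T t g), coeFn_mul (T t f) g,
    coeFn_mul f g] with x h1 h2 h3 h4 h5 h6 h7
  rw [gammaT, h1, Pi.smul_apply, h2, Pi.add_apply, h3, Pi.sub_apply, h4, Pi.sub_apply, h5, h6, h7]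
  have e : mulLinf f g = f * g := rfl
  rw [approxGamma, e, h7, smul_eq_mul, mul_inv]
  ring

lemma gammaT_comm (t : ℝ) (f g : Linf μ) : gammaT T t f g = gammaT T t g f := by
  simp only [gammaT]
  congr 1
  rw [mul_comm f g, mul_comm f (T t g), mul_comm (T t f) g]
  ring

lemma gammaT_add_left (t : ℝ) (f g h : Linf μ) :
    gammaT T t (f + g) h = gammaT T t f h + gammaT T t g h := by
  simp only [gammaT, add_mul, map_add]; module

lemma gammaT_smul_left (t a : ℝ) (f h : Linf μ) :
    gammaT T t (a • f) h = a • gammaT T t f h := by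
  simp only [gammaT, smul_mul_assoc, map_smul]; module

lemma expect_gammaT (hT : IsMarkovSemigroup T) (hs : IsSymmetricSemigroup T) {t : ℝ} (ht : 0 ≤ t)
    (f g : Linf μ) : expect μ (gammaT T t f g) = t⁻¹ * expect μ (f * (g - T t g)) := by
  simp only [gammaT, map_smul, map_add, map_sub, mul_sub, smul_eq_mul]
  rw [expect_map hT hs ht, hs.expect_symm ht f g, mul_inv]
  ring

/-- Symmetry moves `T_t` from the product `f g` to `φ`, so that in the limit no generator falls on a
product. -/
lemma expect_mul_gammaT (hs : IsSymmetricSemigroup T) {t : ℝ}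
    (ht : 0 ≤ t) (φ f g : Linf μ) : expect μ (φ * gammaT T t f g)
      = (t⁻¹ * expect μ ((φ * f) * (g - T t g)) + t⁻¹ * expect μ ((φ * g) * (f - T t f))
        - t⁻¹ * expect μ ((f * g) * (φ - T t φ))) / 2 := by
  have e : φ * gammaT T t f g = (2 * t)⁻¹ • ((φ * f) * (g - T t g) + (φ * g) * (f - T t f)
      - φ * (f * g) + φ * T t (f * g)) := by
    rw [gammaT, mul_smul_comm]
    congr 1
    ring
  rw [e]
  simp only [map_smul, map_add, map_sub, smul_eq_mul, mul_sub (f * g)]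
  rw [hs.expect_symm ht, mul_inv, mul_comm (f * g) φ, mul_comm (f * g) (T t φ)]
  ring

/-- Lipschitz functions contract the approximating gradient forms. -/
lemma gammaT_comp_le (hT : IsMarkovSemigroup T) {t : ℝ} (ht : 0 ≤ t) {ψ : ℝ → ℝ} {K : NNReal}
    (hψ : LipschitzWith K ψ) {g F : Linf μ} (hF : ∀ᵐ x ∂μ, F x = ψ (g x)) :
    gammaT T t F F ≤ ((K : ℝ) ^ 2) • gammaT T t g g := by
  -- This is `T_t` applied to `(F - ψ(a))² ≤ K² (g - a)²`. It must hold for all `a` outside a single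
  -- null set, because `a = g(x)` is substituted below.
  have key : ∀ᵐ x ∂μ, ∀ a : ℝ, 0 ≤ (K : ℝ) ^ 2 * (T t (g * g) x - 2 * a * T t g x + a ^ 2)
      - (T t (F * F) x - 2 * ψ a * T t F x + ψ a ^ 2) := by
    have hc := hψ.continuous
    apply ae_forall_nonneg (fun x => by fun_prop)
    intro a
    have h0 : 0 ≤ ((K : ℝ) ^ 2) • (g * g - (2 * a) • g + (a ^ 2) • (1 : Linf μ))
        - (F * F - (2 * ψ a) • F + (ψ a ^ 2) • (1 : Linf μ)) := by
      rw [linf_nonneg_iff]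
      filter_upwards [hF, coeFn_mul g g, coeFn_mul F F, coeFn_smul_one (μ := μ) (a ^ 2),
        coeFn_smul_one (μ := μ) (ψ a ^ 2), Lp.coeFn_smul (2 * a) g, Lp.coeFn_smul (2 * ψ a) F,
        Lp.coeFn_sub (((K : ℝ) ^ 2) • (g * g - (2 * a) • g + (a ^ 2) • (1 : Linf μ)))
          (F * F - (2 * ψ a) • F + (ψ a ^ 2) • (1 : Linf μ)),
        Lp.coeFn_smul ((K : ℝ) ^ 2) (g * g - (2 * a) • g + (a ^ 2) • (1 : Linf μ)),
        Lp.coeFn_add (g * g - (2 * a) • g) ((a ^ 2) • (1 : Linf μ)),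
        Lp.coeFn_sub (g * g) ((2 * a) • g),
        Lp.coeFn_add (F * F - (2 * ψ a) • F) ((ψ a ^ 2) • (1 : Linf μ)),
        Lp.coeFn_sub (F * F) ((2 * ψ a) • F)] with x h0 h1 h2 h3 h4 h5 h6 h7 h8 h9 h10 h11 h12
      rw [h7, Pi.sub_apply, h8, Pi.smul_apply, h9, Pi.add_apply, h10, Pi.sub_apply, h11,
        Pi.add_apply, h12, Pi.sub_apply, h1, h2, h3, h4, h5, h6, Pi.smul_apply, Pi.smul_apply, h0]
      simp only [smul_eq_mul]
      have h := hψ.dist_le_mul (g x) a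
      rw [Real.dist_eq, Real.dist_eq] at h
      have h' := pow_le_pow_left₀ (abs_nonneg _) h 2
      rw [mul_pow, sq_abs, sq_abs] at h'
      nlinarith
    have h1 := hT.nonneg t ht _ h0
    simp only [map_sub, map_add, map_smul, hT.map_one ht] at h1
    rw [linf_nonneg_iff] at h1
    filter_upwards [h1, coeFn_smul_one (μ := μ) (a ^ 2),
        coeFn_smul_one (μ := μ) (ψ a ^ 2), Lp.coeFn_smul (2 * a) (T t g),
        Lp.coeFn_smul (2 * ψ a) (T t F),
        Lp.coeFn_sub (((K : ℝ) ^ 2) • (T t (g * g) - (2 * a) • T t g + (a ^ 2) • (1 : Linf μ)))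
          (T t (F * F) - (2 * ψ a) • T t F + (ψ a ^ 2) • (1 : Linf μ)),
        Lp.coeFn_smul ((K : ℝ) ^ 2) (T t (g * g) - (2 * a) • T t g + (a ^ 2) • (1 : Linf μ)),
        Lp.coeFn_add (T t (g * g) - (2 * a) • T t g) ((a ^ 2) • (1 : Linf μ)),
        Lp.coeFn_sub (T t (g * g)) ((2 * a) • T t g),
        Lp.coeFn_add (T t (F * F) - (2 * ψ a) • T t F) ((ψ a ^ 2) • (1 : Linf μ)),
        Lp.coeFn_sub (T t (F * F)) ((2 * ψ a) • T t F)] with x h0 h3 h4 h5 h6 h7 h8 h9 h10 h11 h12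
    rw [h7, Pi.sub_apply, h8, Pi.smul_apply, h9, Pi.add_apply, h10, Pi.sub_apply, h11,
        Pi.add_apply, h12, Pi.sub_apply, h3, h4, h5, h6, Pi.smul_apply, Pi.smul_apply] at h0
    simpa only [smul_eq_mul] using h0
  rw [← Lp.coeFn_le]
  filter_upwards [key, hF, approxGamma_ae_eq (T := T) t F F, approxGamma_ae_eq (T := T) t g g,
    Lp.coeFn_smul ((K : ℝ) ^ 2) (gammaT T t g g), coeFn_mul F F, coeFn_mul g g]
    with x hx h0 h1 h2 h3 h4 h5
  rw [h3, Pi.smul_apply, ← h1, ← h2, smul_eq_mul, approxGamma, approxGamma]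
  have e1 : mulLinf F F = F * F := rfl
  have e2 : mulLinf g g = g * g := rfl
  rw [e1, e2, h4, h5]
  have h := hx (g x)
  rw [← h0] at h
  have ht' : 0 ≤ t⁻¹ := by positivity
  have := mul_nonneg ht' h
  simp only [div_eq_mul_inv]
  nlinarith

lemma gammaT_self_nonneg (hT : IsMarkovSemigroup T) {t : ℝ} (ht : 0 ≤ t) (g : Linf μ) :
    0 ≤ gammaT T t g g := by
  rw [linf_nonneg_iff]
  filter_upwards [ae_forall_sq_nonneg (hT.nonneg t ht) (hT.map_one ht) g,
    approxGamma_ae_eq (T := T) t g g, coeFn_mul g g] with x h1 h2 h3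
  rw [← h2, approxGamma]
  have e2 : mulLinf g g = g * g := rfl
  rw [e2, h3]
  have ht' : 0 ≤ t⁻¹ := by positivity
  have := mul_nonneg ht' (h1 (g x))
  simp only [div_eq_mul_inv]
  nlinarith

lemma inDirichletAlgebra_iff (hT : IsMarkovSemigroup T) (hs : IsSymmetricSemigroup T)
    {f : Linf μ} :
    InDirichletAlgebra T f ↔ ∃ C : ℝ, ∀ t, 0 < t → expect μ (gammaT T t f f) ≤ C := by
  rw [InDirichletAlgebra]
  refine exists_congr fun C => forall_congr' fun t => forall_congr' fun ht => ?_
  rw [expect_gammaT hT hs ht.le, expect_mul, inv_mul_eq_div]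
  have : ∫ x, f x * (f x - T t f x) ∂μ = ∫ x, f x * (f - T t f) x ∂μ := by
    apply integral_congr_ae
    filter_upwards [Lp.coeFn_sub f (T t f)] with x hx
    rw [hx, Pi.sub_apply]
  rw [this]

lemma InDirichletAlgebra.comp (hT : IsMarkovSemigroup T) (hs : IsSymmetricSemigroup T)
    {ψ : ℝ → ℝ} {K : NNReal} (hψ : LipschitzWith K ψ) {g F : Linf μ}
    (hg : InDirichletAlgebra T g) (hF : ∀ᵐ x ∂μ, F x = ψ (g x)) : InDirichletAlgebra T F := by
  rw [inDirichletAlgebra_iff hT hs] at *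
  obtain ⟨C, hC⟩ := hg
  refine ⟨(K : ℝ) ^ 2 * C, fun t ht => ?_⟩
  have := expect_mono (gammaT_comp_le hT ht.le hψ hF)
  rw [map_smul, smul_eq_mul] at this
  exact this.trans (mul_le_mul_of_nonneg_left (hC t ht) (by positivity))

lemma InDirichletAlgebra.add (hT : IsMarkovSemigroup T) (hs : IsSymmetricSemigroup T)
    {f g : Linf μ} (hf : InDirichletAlgebra T f) (hg : InDirichletAlgebra T g) :
    InDirichletAlgebra T (f + g) := by
  rw [inDirichletAlgebra_iff hT hs] at *
  obtain ⟨C, hC⟩ := hf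
  obtain ⟨D, hD⟩ := hg
  -- Parallelogram law: the energies of `f + g` and `f - g` add up to twice those of `f` and `g`,
  -- and the energy of `f - g` is nonnegative.
  refine ⟨2 * C + 2 * D, fun t ht => ?_⟩
  have h := expect_nonneg (gammaT_self_nonneg hT ht.le (f + (-1 : ℝ) • g))
  have e : ∀ a : ℝ, expect μ (gammaT T t (f + a • g) (f + a • g))
      = expect μ (gammaT T t f f) + 2 * a * expect μ (gammaT T t f g)
        + a ^ 2 * expect μ (gammaT T t g g) := by
    intro a
    rw [gammaT_add_left, gammaT_smul_left, gammaT_comm _ f, gammaT_comm _ g, gammaT_add_left,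
      gammaT_smul_left, gammaT_add_left, gammaT_smul_left, gammaT_comm _ g f]
    simp only [map_add, map_smul, smul_eq_mul]; ring
  have e1 := e 1
  rw [one_smul] at e1
  rw [e] at h
  have := hC t ht
  have := hD t ht
  linarith

lemma InDirichletAlgebra.smul (hT : IsMarkovSemigroup T) (hs : IsSymmetricSemigroup T)
    {f : Linf μ} (hf : InDirichletAlgebra T f) (a : ℝ) : InDirichletAlgebra T (a • f) := by
  rw [inDirichletAlgebra_iff hT hs] at *
  obtain ⟨C, hC⟩ := hf
  refine ⟨a ^ 2 * C, fun t ht => ?_⟩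
  rw [gammaT_smul_left, gammaT_comm, gammaT_smul_left, smul_smul, map_smul, smul_eq_mul, ← sq]
  exact mul_le_mul_of_nonneg_left (hC t ht) (by positivity)

lemma InDirichletAlgebra.sub (hT : IsMarkovSemigroup T) (hs : IsSymmetricSemigroup T)
    {f g : Linf μ} (hf : InDirichletAlgebra T f) (hg : InDirichletAlgebra T g) :
    InDirichletAlgebra T (f - g) := by
  have := hf.add hT hs (hg.smul hT hs (-1))
  rwa [neg_one_smul, ← sub_eq_add_neg] at this

lemma inDirichletAlgebra_one (hT : IsMarkovSemigroup T) (hs : IsSymmetricSemigroup T) :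
    InDirichletAlgebra T (1 : Linf μ) := by
  rw [inDirichletAlgebra_iff hT hs]
  refine ⟨0, fun t ht => ?_⟩
  rw [expect_gammaT hT hs ht.le, hT.map_one ht.le]
  simp

lemma HasGenerator.inDirichletAlgebra (hT : IsMarkovSemigroup T) (hs : IsSymmetricSemigroup T)
    {f : Linf μ} {g : Ω → ℝ} (h : HasGenerator T f g) : InDirichletAlgebra T f := by
  rw [inDirichletAlgebra_iff hT hs]
  have h1 := h.tendsto_expect hT hs f
  set D := ∫ x, f x * g x ∂μ
  have h2 := h1.eventually (gt_mem_nhds (lt_add_one D))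
  obtain ⟨δ, hδ, h3⟩ := mem_nhdsGT_iff_exists_Ioo_subset.1 h2
  have hδ' : (0:ℝ) < δ := hδ
  -- For `t < δ` the approximating energy is near its limit `D = ⟨f, A f⟩`; for `t ≥ δ` it is at
  -- most `‖f‖₂² / δ`, since `⟨f, T_t f⟩ ≥ 0`.
  refine ⟨max (D + 1) (δ⁻¹ * expect μ (f * f)), fun t ht => ?_⟩
  rw [expect_gammaT hT hs ht.le]
  rcases lt_or_ge t δ with hlt | hge
  · exact (le_of_lt (h3 ⟨ht, hlt⟩)).trans (le_max_left _ _)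
  · refine le_trans ?_ (le_max_right _ _)
    have e : expect μ (f * T t f) = expect μ (T (t / 2) f * T (t / 2) f) := by
      have : T t f = T (t / 2) (T (t / 2) f) := by
        rw [← hT.add_apply (by positivity) (by positivity), add_halves]
      rw [this, hs.expect_symm (by positivity)]
    have e2 := expect_nonneg (linf_mul_self_nonneg (T (t / 2) f))
    have e3 := expect_nonneg (linf_mul_self_nonneg f)
    rw [mul_sub, map_sub, e]
    exact mul_le_mul (inv_anti₀ hδ' hge) (by linarith)
      (sub_nonneg.2 (expect_map_mul_map_le hT hs (by positivity) f)) (by positivity)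

/-- The integral of `φ` against an `L_1`-limit of the gradient forms. -/
lemma HasGamma.tendsto {f g : Linf μ} {γ : Ω → ℝ} (h : HasGamma T f g γ) (φ : Linf μ) :
    Tendsto (fun t : ℝ => expect μ (φ * gammaT T t f g)) (𝓝[>] 0) (𝓝 (∫ x, φ x * γ x ∂μ)) := by
  rw [tendsto_iff_norm_sub_tendsto_zero]
  have h0 : Tendsto (fun t : ℝ => ‖φ‖ * (eLpNorm (fun x => approxGamma T t f g x - γ x) 1 μ).toReal)
      (𝓝[>] 0) (𝓝 0) := by
    have := ((ENNReal.tendsto_toReal ENNReal.zero_ne_top).comp h.2).const_mul ‖φ‖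
    simpa using this
  refine squeeze_zero (fun _ => norm_nonneg _) (fun t => ?_) h0
  have hi : Integrable (fun x => gammaT T t f g x - γ x) μ := (linf_integrable _).sub h.1
  have e1 : expect μ (φ * gammaT T t f g) - ∫ x, φ x * γ x ∂μ
      = ∫ x, φ x * (gammaT T t f g x - γ x) ∂μ := by
    rw [expect_mul, ← integral_sub (linf_mul_integrable _ (linf_integrable _))
      (linf_mul_integrable _ h.1)]
    simp only [mul_sub]
  have e2 : (eLpNorm (fun x => approxGamma T t f g x - γ x) 1 μ).toReal
      = ∫ x, ‖gammaT T t f g x - γ x‖ ∂μ := by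
    rw [integral_norm_eq_lintegral_enorm hi.1, ← eLpNorm_one_eq_lintegral_enorm]
    congr 1
    apply eLpNorm_congr_ae
    filter_upwards [approxGamma_ae_eq (T := T) t f g] with x hx
    rw [hx]
  rw [e1, e2, ← integral_const_mul]
  refine (norm_integral_le_integral_norm _).trans ?_
  apply integral_mono_ae (linf_mul_integrable φ hi).norm (hi.norm.const_mul _)
  filter_upwards [linf_ae_abs_le φ] with x hx
  simp only [norm_mul]
  exact mul_le_mul_of_nonneg_right hx (norm_nonneg _)

open Classical in
/-- The gradient form `Γ(f, g)` as an element of `L_1`. -/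
def carre (T : ℝ → Linf μ →L[ℝ] Linf μ) (f g : Linf μ) : Lp ℝ 1 μ :=
  if h : ∃ γ : Lp ℝ 1 μ, HasGamma T f g γ then h.choose else 0

/-- `∫ φ Γ(f, g)`. -/
def carreInt (T : ℝ → Linf μ →L[ℝ] Linf μ) (f g : Linf μ) : Linf μ →L[ℝ] ℝ :=
  pairing μ (carre T f g)

lemma carreInt_apply (f g φ : Linf μ) : carreInt T f g φ = ∫ x, φ x * carre T f g x ∂μ :=
  pairing_apply _ _

lemma HasGamma.congr {f g : Linf μ} {γ γ' : Ω → ℝ} (h : HasGamma T f g γ) (hγ : γ =ᵐ[μ] γ') :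
    HasGamma T f g γ' := by
  refine ⟨h.1.congr hγ, h.2.congr fun t => eLpNorm_congr_ae ?_⟩
  filter_upwards [hγ] with x hx
  rw [hx]

lemma hasGamma_carre (hd : IsDiffusion T) {f g : Linf μ} (hf : InDirichletAlgebra T f)
    (hg : InDirichletAlgebra T g) : HasGamma T f g (carre T f g) := by
  have h : ∃ γ : Lp ℝ 1 μ, HasGamma T f g γ := by
    obtain ⟨γ, hγ⟩ := hd.exists_gamma f g hf hg
    have hm := memLp_one_iff_integrable.2 hγ.1
    exact ⟨hm.toLp γ, hγ.congr hm.coeFn_toLp.symm⟩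
  rw [carre, dif_pos h]
  exact h.choose_spec

lemma tendsto_carreInt (hd : IsDiffusion T) {f g : Linf μ} (hf : InDirichletAlgebra T f)
    (hg : InDirichletAlgebra T g) (φ : Linf μ) :
    Tendsto (fun t : ℝ => expect μ (φ * gammaT T t f g)) (𝓝[>] 0) (𝓝 (carreInt T f g φ)) := by
  rw [carreInt_apply]
  exact (hasGamma_carre hd hf hg).tendsto φ

lemma carreInt_comm (hd : IsDiffusion T) {f g : Linf μ} (hf : InDirichletAlgebra T f)
    (hg : InDirichletAlgebra T g) (φ : Linf μ) : carreInt T f g φ = carreInt T g f φ := by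
  refine tendsto_nhds_unique (tendsto_carreInt hd hf hg φ)
    ((tendsto_carreInt hd hg hf φ).congr fun t => ?_)
  rw [gammaT_comm]

lemma carreInt_add_left (hT : IsMarkovSemigroup T) (hs : IsSymmetricSemigroup T)
    (hd : IsDiffusion T) {f g h : Linf μ} (hf : InDirichletAlgebra T f)
    (hg : InDirichletAlgebra T g) (hh : InDirichletAlgebra T h) (φ : Linf μ) :
    carreInt T (f + g) h φ = carreInt T f h φ + carreInt T g h φ := by
  refine tendsto_nhds_unique (tendsto_carreInt hd (hf.add hT hs hg) hh φ)
    (((tendsto_carreInt hd hf hh φ).add (tendsto_carreInt hd hg hh φ)).congr fun t => ?_)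
  rw [gammaT_add_left, mul_add, map_add]

lemma carreInt_smul_left (hT : IsMarkovSemigroup T) (hs : IsSymmetricSemigroup T)
    (hd : IsDiffusion T) {f h : Linf μ} (hf : InDirichletAlgebra T f)
    (hh : InDirichletAlgebra T h) (a : ℝ) (φ : Linf μ) :
    carreInt T (a • f) h φ = a * carreInt T f h φ := by
  refine tendsto_nhds_unique (tendsto_carreInt hd (hf.smul hT hs a) hh φ)
    (((tendsto_carreInt hd hf hh φ).const_mul a).congr fun t => ?_)
  rw [gammaT_smul_left, mul_smul_comm, map_smul, smul_eq_mul]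

lemma carreInt_self_nonneg (hT : IsMarkovSemigroup T) (hd : IsDiffusion T) {f : Linf μ}
    (hf : InDirichletAlgebra T f) {φ : Linf μ} (hφ : 0 ≤ φ) : 0 ≤ carreInt T f f φ := by
  refine ge_of_tendsto (tendsto_carreInt hd hf hf φ) ?_
  filter_upwards [self_mem_nhdsWithin] with t ht
  exact expect_nonneg (linf_mul_nonneg hφ (gammaT_self_nonneg hT (le_of_lt ht) f))

lemma carreInt_mul_left (hd : IsDiffusion T) {f g h : Linf μ} (hf : InDirichletAlgebra T f)
    (hh : InDirichletAlgebra T h) (hg : InDirichletAlgebra T g)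
    (hfh : InDirichletAlgebra T (f * h)) (φ : Linf μ) :
    carreInt T (f * h) g φ = carreInt T h g (φ * f) + carreInt T f g (φ * h) := by
  have h1 := (hd.product_rule f h g hf hh hg _ _ (hasGamma_carre hd hh hg)
    (hasGamma_carre hd hf hg)).tendsto φ
  refine (tendsto_nhds_unique (tendsto_carreInt hd hfh hg φ) h1).trans ?_
  rw [carreInt_apply, carreInt_apply, ← integral_add
    (linf_mul_integrable _ (hasGamma_carre hd hh hg).1)
    (linf_mul_integrable _ (hasGamma_carre hd hf hg).1)]
  apply integral_congr_ae
  filter_upwards [coeFn_mul φ f, coeFn_mul φ h] with x h1 h2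
  rw [h1, h2]; ring

lemma carreInt_comp_le (hT : IsMarkovSemigroup T) (hs : IsSymmetricSemigroup T)
    (hd : IsDiffusion T) {ψ : ℝ → ℝ} {K : NNReal} (hψ : LipschitzWith K ψ) {g F : Linf μ}
    (hg : InDirichletAlgebra T g) (hF : ∀ᵐ x ∂μ, F x = ψ (g x)) :
    carreInt T F F 1 ≤ (K : ℝ) ^ 2 * carreInt T g g 1 := by
  have hF' := hg.comp hT hs hψ hF
  refine le_of_tendsto_of_tendsto (tendsto_carreInt hd hF' hF' 1)
    ((tendsto_carreInt hd hg hg 1).const_mul _) ?_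
  filter_upwards [self_mem_nhdsWithin] with t ht
  rw [one_mul, one_mul]
  have := expect_mono (gammaT_comp_le hT (le_of_lt ht) hψ hF)
  rwa [map_smul, smul_eq_mul] at this

lemma carreInt_expand (hT : IsMarkovSemigroup T) (hs : IsSymmetricSemigroup T)
    (hd : IsDiffusion T) {f g : Linf μ} (hf : InDirichletAlgebra T f)
    (hg : InDirichletAlgebra T g) (a : ℝ) (φ : Linf μ) :
    carreInt T (f + a • g) (f + a • g) φ
      = carreInt T f f φ + 2 * a * carreInt T f g φ + a ^ 2 * carreInt T g g φ := by
  have hag := hg.smul hT hs a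
  have hfg := hf.add hT hs hag
  rw [carreInt_add_left hT hs hd hf hag hfg, carreInt_smul_left hT hs hd hg hfg,
    carreInt_comm hd hf hfg, carreInt_comm hd hg hfg, carreInt_add_left hT hs hd hf hag hf,
    carreInt_add_left hT hs hd hf hag hg, carreInt_smul_left hT hs hd hg hf,
    carreInt_smul_left hT hs hd hg hg, carreInt_comm hd hg hf]
  ring

/-- A weighted Cauchy–Schwarz inequality for the gradient form. -/
lemma two_mul_carreInt_le (hT : IsMarkovSemigroup T) (hs : IsSymmetricSemigroup T)
    (hd : IsDiffusion T) {f g : Linf μ} (hf : InDirichletAlgebra T f)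
    (hg : InDirichletAlgebra T g) {φ : Linf μ} (hφ : 0 ≤ φ) {κ : ℝ} (hκ : 0 < κ) :
    2 * carreInt T f g φ ≤ κ * carreInt T f f φ + κ⁻¹ * carreInt T g g φ := by
  have h := carreInt_self_nonneg hT hd (hf.add hT hs (hg.smul hT hs (-κ⁻¹))) hφ
  rw [carreInt_expand hT hs hd hf hg] at h
  have h2 := mul_nonneg hκ.le h
  have e : κ * (carreInt T f f φ + 2 * -κ⁻¹ * carreInt T f g φ + (-κ⁻¹) ^ 2 * carreInt T g g φ)
      = κ * carreInt T f f φ - 2 * carreInt T f g φ + κ⁻¹ * carreInt T g g φ := by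
    field_simp
    ring
  linarith

lemma abs_two_mul_carreInt_le (hT : IsMarkovSemigroup T) (hs : IsSymmetricSemigroup T)
    (hd : IsDiffusion T) {f g : Linf μ} (hf : InDirichletAlgebra T f)
    (hg : InDirichletAlgebra T g) {φ : Linf μ} (hφ : 0 ≤ φ) {κ : ℝ} (hκ : 0 < κ) :
    |2 * carreInt T f g φ| ≤ κ * carreInt T f f φ + κ⁻¹ * carreInt T g g φ := by
  rw [abs_le]
  refine ⟨?_, two_mul_carreInt_le hT hs hd hf hg hφ hκ⟩
  have hf' := hf.smul hT hs (-1)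
  have h := two_mul_carreInt_le hT hs hd hf' hg hφ hκ
  rw [carreInt_smul_left hT hs hd hf hf', carreInt_comm hd hf hf',
    carreInt_smul_left hT hs hd hf hf, carreInt_smul_left hT hs hd hf hg] at h
  linarith

/-- Integration by parts: the approximating energies are exactly `⟨f, g - T_t g⟩ / t`. -/
lemma carreInt_one_of_hasGenerator (hT : IsMarkovSemigroup T) (hs : IsSymmetricSemigroup T)
    (hd : IsDiffusion T) {f g : Linf μ} {Ag : Ω → ℝ} (hf : InDirichletAlgebra T f)
    (hg : HasGenerator T g Ag) : carreInt T f g 1 = ∫ x, f x * Ag x ∂μ := by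
  refine tendsto_nhds_unique (tendsto_carreInt hd hf (hg.inDirichletAlgebra hT hs) 1)
    ((hg.tendsto_expect hT hs f).congr' ?_)
  filter_upwards [self_mem_nhdsWithin] with t ht
  rw [one_mul, expect_gammaT hT hs (le_of_lt ht)]

/-- Rewrites the `L_1` object `Γ` through expectations of products in `L_∞`, which can be
differentiated in time by the product rule. -/
lemma carreInt_of_hasGenerator (hT : IsMarkovSemigroup T) (hs : IsSymmetricSemigroup T)
    (hd : IsDiffusion T) {f g φ Af Ag Aφ : Linf μ} (hf : HasGenerator T f Af)
    (hg : HasGenerator T g Ag) (hφ : HasGenerator T φ Aφ) :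
    carreInt T f g φ
      = (expect μ ((φ * f) * Ag) + expect μ ((φ * g) * Af) - expect μ ((f * g) * Aφ)) / 2 := by
  refine tendsto_nhds_unique (tendsto_carreInt hd (hf.inDirichletAlgebra hT hs)
    (hg.inDirichletAlgebra hT hs) φ) ?_
  have h1 := hg.tendsto_expect hT hs (φ * f)
  have h2 := hf.tendsto_expect hT hs (φ * g)
  have h3 := hφ.tendsto_expect hT hs (f * g)
  rw [← expect_mul] at h1 h2 h3
  refine (((h1.add h2).sub h3).div_const 2).congr' ?_
  filter_upwards [self_mem_nhdsWithin] with t ht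
  rw [expect_mul_gammaT hs (le_of_lt ht)]

lemma tendsto_carreInt_map (hT : IsMarkovSemigroup T) (f g φ : Linf μ) :
    Tendsto (fun v => carreInt T f g (T v φ)) (𝓝[>] 0) (𝓝 (carreInt T f g φ)) := by
  have h := hT.ultraweak_continuous φ (carre T f g) (L1.integrable_coeFn _) 0 (Set.mem_Ici.2 le_rfl)
  have h2 := h.tendsto.mono_left (nhdsWithin_mono 0 Set.Ioi_subset_Ici_self)
  simp only [carreInt_apply]
  simp only [hT.zero_apply] at h2
  simp only [mul_comm] at h2 ⊢
  exact h2

end GradientForm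

/-! ### The chain rule for the exponential -/

section ChainRule

variable {T : ℝ → Linf μ →L[ℝ] Linf μ}

lemma linf_norm_le {f : Linf μ} {C : ℝ} (hC : 0 ≤ C) (h : ∀ᵐ x ∂μ, |f x| ≤ C) : ‖f‖ ≤ C := by
  have := Lp.norm_le_of_ae_bound hC (f := f) h
  simpa using this

/-- A differentiable function agrees on an interval with a globally Lipschitz one. -/
lemma exists_lipschitzWith_eqOn {ψ ψ' : ℝ → ℝ} {R : ℝ} {K : NNReal}
    (hd : ∀ y, HasDerivAt ψ (ψ' y) y) (hb : ∀ y, |y| ≤ R → |ψ' y| ≤ K) :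
    ∃ ψ₁ : ℝ → ℝ, LipschitzWith K ψ₁ ∧ ∀ y, |y| ≤ R → ψ y = ψ₁ y := by
  have h : LipschitzOnWith K ψ (Set.Icc (-R) R) := by
    apply (convex_Icc (-R) R).lipschitzOnWith_of_nnnorm_hasDerivWithin_le
      (fun y _ => (hd y).hasDerivWithinAt)
    intro y hy
    rw [← NNReal.coe_le_coe, coe_nnnorm]
    exact hb y (abs_le.2 hy)
  obtain ⟨ψ₁, h1, h2⟩ := h.extend_real
  exact ⟨ψ₁, h1, fun y hy => h2 (abs_le.1 hy)⟩

lemma InDirichletAlgebra.pow (hT : IsMarkovSemigroup T) (hs : IsSymmetricSemigroup T)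
    {g : Linf μ} (hg : InDirichletAlgebra T g) (n : ℕ) : InDirichletAlgebra T (g ^ n) := by
  obtain ⟨ψ, h1, h2⟩ := exists_lipschitzWith_eqOn (ψ := fun y : ℝ => y ^ n)
    (ψ' := fun y => n * y ^ (n - 1)) (R := ‖g‖)
    (K := ⟨n * ‖g‖ ^ (n - 1), by positivity⟩) (fun y => by simpa using hasDerivAt_pow n y)
    (fun y hy => by
      rw [abs_mul, abs_pow, Nat.abs_cast]
      change _ ≤ n * ‖g‖ ^ (n - 1)
      gcongr)
  refine hg.comp hT hs h1 ?_
  filter_upwards [coeFn_pow g n, linf_ae_abs_le g] with x h3 h4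
  rw [h3, ← h2 _ h4]

lemma carreInt_pow_succ (hT : IsMarkovSemigroup T) (hs : IsSymmetricSemigroup T)
    (hd : IsDiffusion T) {g h : Linf μ} (hg : InDirichletAlgebra T g)
    (hh : InDirichletAlgebra T h) (n : ℕ) (φ : Linf μ) :
    carreInt T (g ^ (n + 1)) h φ = (n + 1) * carreInt T g h (φ * g ^ n) := by
  induction n generalizing φ with
  | zero => simp
  | succ n ih =>
    have hfh : InDirichletAlgebra T (g ^ (n + 1) * g) := by
      rw [← pow_succ]; exact hg.pow hT hs _
    rw [pow_succ g (n + 1), carreInt_mul_left hd (hg.pow hT hs _) hg hh hfh, ih,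
      mul_assoc, ← pow_succ']
    push_cast; ring

/-- The Taylor polynomials of the exponential function, evaluated in `L_∞`. -/
def expPoly (g : Linf μ) (n : ℕ) : Linf μ :=
  ∑ k ∈ Finset.range n, ((k.factorial : ℝ)⁻¹) • g ^ k

lemma coeFn_expPoly (g : Linf μ) (n : ℕ) :
    ⇑(expPoly g n) =ᵐ[μ] fun x => ∑ k ∈ Finset.range n, g x ^ k / (k.factorial : ℝ) := by
  induction n with
  | zero => simpa [expPoly] using! Lp.coeFn_zero ℝ ∞ μ
  | succ n ih =>
    have e : expPoly g (n + 1) = expPoly g n + ((n.factorial : ℝ)⁻¹) • g ^ n :=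
      Finset.sum_range_succ _ _
    rw [e]
    filter_upwards [ih, Lp.coeFn_add (expPoly g n) (((n.factorial : ℝ)⁻¹) • g ^ n),
      Lp.coeFn_smul ((n.factorial : ℝ)⁻¹) (g ^ n), coeFn_pow g n] with x h1 h2 h3 h4
    rw [h2, Pi.add_apply, h1, h3, Pi.smul_apply, h4, Finset.sum_range_succ, smul_eq_mul,
      inv_mul_eq_div]

lemma InDirichletAlgebra.expPoly (hT : IsMarkovSemigroup T) (hs : IsSymmetricSemigroup T)
    {g : Linf μ} (hg : InDirichletAlgebra T g) (n : ℕ) :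
    InDirichletAlgebra T (expPoly g n) := by
  induction n with
  | zero =>
    have := (inDirichletAlgebra_one hT hs).smul hT hs 0
    simpa [DiffusionMLSI.expPoly] using this
  | succ n ih =>
    have e : DiffusionMLSI.expPoly g (n + 1)
        = DiffusionMLSI.expPoly g n + ((n.factorial : ℝ)⁻¹) • g ^ n :=
      Finset.sum_range_succ _ _
    rw [e]
    exact ih.add hT hs ((hg.pow hT hs n).smul hT hs _)

lemma carreInt_one_left (hT : IsMarkovSemigroup T) (hs : IsSymmetricSemigroup T)
    (hd : IsDiffusion T) {h : Linf μ} (hh : InDirichletAlgebra T h) :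
    carreInt T 1 h 1 = 0 := by
  refine tendsto_nhds_unique (tendsto_carreInt hd (inDirichletAlgebra_one hT hs) hh 1)
    (tendsto_const_nhds.congr' ?_)
  filter_upwards [self_mem_nhdsWithin] with t ht
  rw [one_mul, expect_gammaT hT hs (le_of_lt ht), one_mul, map_sub,
    expect_map hT hs (le_of_lt ht)]
  simp

/-- The index drops by one because the derivative of each Taylor polynomial of `exp` is the
preceding one. -/
lemma carreInt_expPoly (hT : IsMarkovSemigroup T) (hs : IsSymmetricSemigroup T)
    (hd : IsDiffusion T) {g h : Linf μ} (hg : InDirichletAlgebra T g)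
    (hh : InDirichletAlgebra T h) (n : ℕ) :
    carreInt T (expPoly g (n + 1)) h 1 = carreInt T g h (expPoly g n) := by
  induction n with
  | zero => simpa [expPoly] using carreInt_one_left hT hs hd hh
  | succ n ih =>
    have e : ∀ n, expPoly g (n + 1) = expPoly g n + ((n.factorial : ℝ)⁻¹) • g ^ n :=
      fun n => Finset.sum_range_succ _ _
    rw [e (n + 1), carreInt_add_left hT hs hd (hg.expPoly hT hs _)
      ((hg.pow hT hs _).smul hT hs _) hh, ih,
      carreInt_smul_left hT hs hd (hg.pow hT hs _) hh, carreInt_pow_succ hT hs hd hg hh, one_mul,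
      e n, map_add, map_smul, smul_eq_mul, Nat.factorial_succ]
    push_cast
    have : (n.factorial : ℝ) ≠ 0 := by positivity
    field_simp

lemma abs_exp_sub_sum_le {R y : ℝ} {n : ℕ} (hy : |y| ≤ R) (hn : R / (n + 1) ≤ 1 / 2) :
    |Real.exp y - ∑ k ∈ Finset.range n, y ^ k / (k.factorial : ℝ)|
      ≤ R ^ n / (n.factorial : ℝ) * 2 := by
  have h := Complex.exp_bound' (x := (y : ℂ)) (n := n) (by
    rw [Complex.norm_real, Real.norm_eq_abs]
    refine le_trans ?_ hn
    push_cast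
    gcongr)
  rw [Complex.norm_real, Real.norm_eq_abs] at h
  have e : Complex.exp (y : ℂ) - ∑ m ∈ Finset.range n, (y : ℂ) ^ m / (m.factorial : ℂ)
      = ((Real.exp y - ∑ k ∈ Finset.range n, y ^ k / (k.factorial : ℝ) : ℝ) : ℂ) := by
    push_cast; rfl
  rw [e, Complex.norm_real, Real.norm_eq_abs] at h
  refine h.trans ?_
  gcongr

/-- As each Taylor remainder differentiates to the preceding one, its Lipschitz constant on `[-R,
R]` is small, and with it the energy of the remainder. -/
lemma hasDerivAt_exp_sub_sum (n : ℕ) (y : ℝ) :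
    HasDerivAt (fun y => Real.exp y - ∑ k ∈ Finset.range (n + 1), y ^ k / (k.factorial : ℝ))
      (Real.exp y - ∑ k ∈ Finset.range n, y ^ k / (k.factorial : ℝ)) y := by
  refine (Real.hasDerivAt_exp y).sub ?_
  induction n with
  | zero => simpa using hasDerivAt_const y (1:ℝ)
  | succ n ih =>
    simp only [Finset.sum_range_succ _ (n + 1)]
    rw [Finset.sum_range_succ _ n]
    refine ih.add ?_
    have h := (hasDerivAt_pow (n + 1) y).div_const ((n + 1).factorial : ℝ)
    have e : y ^ n / (n.factorial : ℝ)
        = ((n + 1 : ℕ) : ℝ) * y ^ (n + 1 - 1) / ((n + 1).factorial : ℝ) := by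
      have : (n.factorial : ℝ) ≠ 0 := by positivity
      rw [Nat.factorial_succ, Nat.add_sub_cancel]
      push_cast
      field_simp
    rw [e]
    exact h

/-- The chain rule `∫ Γ(e^g, h) = ∫ e^g Γ(g, h)`. -/
lemma carreInt_exp (hT : IsMarkovSemigroup T) (hs : IsSymmetricSemigroup T)
    (hd : IsDiffusion T) {g h F : Linf μ} (hg : InDirichletAlgebra T g)
    (hh : InDirichletAlgebra T h) (hFd : InDirichletAlgebra T F)
    (hF : ∀ᵐ x ∂μ, F x = Real.exp (g x)) :
    carreInt T F h 1 = carreInt T g h F := by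
  set R := ‖g‖
  have hR : 0 ≤ R := norm_nonneg g
  let ε : ℕ → ℝ := fun n => R ^ n / (n.factorial : ℝ) * 2
  have hε : Tendsto ε atTop (𝓝 0) := by
    simpa using (FloorSemiring.tendsto_pow_div_factorial_atTop R).mul_const 2
  have hN : ∀ᶠ n : ℕ in atTop, R / (n + 1) ≤ 1 / 2 := by
    have h1 : Tendsto (fun n : ℕ => R / ((n : ℝ) + 1)) atTop (𝓝 0) :=
      tendsto_const_nhds.div_atTop
        (tendsto_atTop_add_const_right _ _ tendsto_natCast_atTop_atTop)
    exact h1.eventually (ge_mem_nhds (by norm_num))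
  have hbound : ∀ᶠ n in atTop, |carreInt T F h 1 - carreInt T g h F|
      ≤ ε n * (carreInt T g g 1 + carreInt T h h 1) + ‖carreInt T g h‖ * ε n := by
    filter_upwards [hN] with n hn
    have hr : InDirichletAlgebra T (F - expPoly g (n + 1)) :=
      hFd.sub hT hs (hg.expPoly hT hs _)
    have e1 : carreInt T F h 1
        = carreInt T (F - expPoly g (n + 1)) h 1 + carreInt T g h (expPoly g n) := by
      rw [← carreInt_expPoly hT hs hd hg hh, ← carreInt_add_left hT hs hd hr
        (hg.expPoly hT hs _) hh, sub_add_cancel]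
    have e2 : carreInt T F h 1 - carreInt T g h F
        = carreInt T (F - expPoly g (n + 1)) h 1 + carreInt T g h (expPoly g n - F) := by
      rw [e1, map_sub]; ring
    have hεn : 0 ≤ ε n := by simp only [ε]; positivity
    have b1 : ‖expPoly g n - F‖ ≤ ε n := by
      apply linf_norm_le hεn
      filter_upwards [hF, coeFn_expPoly g n, Lp.coeFn_sub (expPoly g n) F, linf_ae_abs_le g]
        with x h1 h2 h3 h4
      rw [h3, Pi.sub_apply, h1, h2, abs_sub_comm]
      exact abs_exp_sub_sum_le h4 hn
    have b2 : |carreInt T g h (expPoly g n - F)| ≤ ‖carreInt T g h‖ * ε n :=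
      ((carreInt T g h).le_opNorm _).trans (mul_le_mul_of_nonneg_left b1 (norm_nonneg _))
    have b3 : carreInt T (F - expPoly g (n + 1)) (F - expPoly g (n + 1)) 1
        ≤ ε n ^ 2 * carreInt T g g 1 := by
      obtain ⟨ψ, h1, h2⟩ := exists_lipschitzWith_eqOn (R := R) (K := ⟨ε n, hεn⟩)
        (hasDerivAt_exp_sub_sum n) (fun y hy => abs_exp_sub_sum_le hy hn)
      refine carreInt_comp_le hT hs hd h1 hg ?_
      filter_upwards [hF, coeFn_expPoly g (n + 1), Lp.coeFn_sub F (expPoly g (n + 1)),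
        linf_ae_abs_le g] with x h3 h4 h5 h6
      rw [← h2 _ h6, h5, Pi.sub_apply, h3, h4]
    have hgg := carreInt_self_nonneg hT hd hg (linf_one_nonneg (μ := μ))
    have hhh := carreInt_self_nonneg hT hd hh (linf_one_nonneg (μ := μ))
    have b4 : |carreInt T (F - expPoly g (n + 1)) h 1|
        ≤ ε n * (carreInt T g g 1 + carreInt T h h 1) := by
      have hrr := carreInt_self_nonneg hT hd hr (linf_one_nonneg (μ := μ))
      -- The optimal Cauchy–Schwarz weight is `1 / ε n`. If `ε n = 0` the remainder has zero energy,
      -- and arbitrarily large weights kill the cross term.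
      rcases hεn.eq_or_lt with h0 | hpos
      · have hz : carreInt T (F - expPoly g (n + 1)) (F - expPoly g (n + 1)) 1 = 0 := by
          rw [← h0] at b3
          exact le_antisymm (by simpa using b3) hrr
        rw [← h0, zero_mul]
        apply le_of_forall_pos_le_add
        intro δ hδ
        have hκ : 0 < (carreInt T h h 1 + 1) / δ := by positivity
        have := abs_two_mul_carreInt_le hT hs hd hr hh (linf_one_nonneg (μ := μ)) hκ
        rw [hz, abs_mul, abs_two, mul_zero, zero_add, inv_div, div_mul_eq_mul_div] at this
        have h3 : δ * carreInt T h h 1 / (carreInt T h h 1 + 1) ≤ δ := by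
          rw [div_le_iff₀ (by positivity)]; nlinarith
        linarith [abs_nonneg (carreInt T (F - expPoly g (n + 1)) h 1)]
      · have := abs_two_mul_carreInt_le hT hs hd hr hh (linf_one_nonneg (μ := μ))
          (inv_pos.2 hpos)
        rw [abs_mul, abs_two, inv_inv] at this
        have h3 : (ε n)⁻¹ * carreInt T (F - expPoly g (n + 1)) (F - expPoly g (n + 1)) 1
            ≤ ε n * carreInt T g g 1 := by
          rw [inv_mul_le_iff₀ hpos]
          calc _ ≤ ε n ^ 2 * carreInt T g g 1 := b3
            _ = _ := by ring
        linarith [abs_nonneg (carreInt T (F - expPoly g (n + 1)) h 1)]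
    rw [e2]
    exact (abs_add_le _ _).trans (add_le_add b4 b2)
  have hlim : Tendsto (fun n => ε n * (carreInt T g g 1 + carreInt T h h 1)
      + ‖carreInt T g h‖ * ε n) atTop (𝓝 0) := by
    simpa using (hε.mul_const (carreInt T g g 1 + carreInt T h h 1)).add
      (hε.const_mul ‖carreInt T g h‖)
  have := ge_of_tendsto hlim hbound
  exact sub_eq_zero.1 (abs_nonpos_iff.1 this)

end ChainRule

/-! ### The Bakry–Émery gradient estimate -/

section GradientEstimate

variable {T : ℝ → Linf μ →L[ℝ] Linf μ}

/-- Orbits are twice differentiable in `L_∞` at positive times. -/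
lemma exists_orbit_derivatives (hT : IsMarkovSemigroup T) (hs : IsSymmetricSemigroup T)
    {c d : ℝ} (hV : VaropoulosBound T c d) (hc : 0 < c) (f : Linf μ) :
    ∃ a b : ℝ → Linf μ, ∀ s, 0 < s →
      HasDerivAt (fun r => T r f) (-(a s)) s ∧ HasGenerator T (T s f) (a s) ∧
        HasDerivAt a (-(b s)) s ∧ HasGenerator T (a s) (b s) := by
  have h1 : ∀ f : Linf μ, ∀ s : ℝ, ∃ g : Linf μ, 0 < s →
      HasDerivAt (fun r => T r f) (-g) s ∧ HasGenerator T (T s f) g := by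
    intro f s
    by_cases h : 0 < s
    · obtain ⟨g, hg⟩ := exists_hasDerivAt_hasGenerator hT hs hV hc f h
      exact ⟨g, fun _ => hg⟩
    · exact ⟨0, fun h' => absurd h' h⟩
  choose D hD using h1
  -- The derivative is itself an orbit from any earlier positive time, so it can be differentiated
  -- again; below `r = s / 2`.
  have key : ∀ r s, 0 < r → r < s → D f s = T (s - r) (D f r) := by
    intro r s hr hrs
    have e : T s f = T (s - r) (T r f) := by
      rw [← hT.add_apply (by linarith) hr.le]; congr 2; ring
    have h2 := (hD f s (hr.trans hrs)).2
    rw [e] at h2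
    exact h2.unique hT hs ((hD f r hr).2.map_linf hT hs (by linarith))
  refine ⟨D f, fun s => D (D f (s / 2)) (s / 2), fun s h0 => ⟨(hD f s h0).1, (hD f s h0).2, ?_, ?_⟩⟩
  · have h2 := (hD (D f (s / 2)) (s / 2) (by positivity)).1
    have h3 : HasDerivAt (fun r : ℝ => r - s / 2) 1 s := (hasDerivAt_id s).sub_const _
    have h2' : HasDerivAt (fun r => T r (D f (s / 2)))
        (-(D (D f (s / 2)) (s / 2))) (s - s / 2) := by
      rwa [sub_half]
    have h4 := h2'.scomp s h3
    rw [one_smul] at h4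
    refine h4.congr_of_eventuallyEq ?_
    filter_upwards [lt_mem_nhds (half_lt_self h0)] with r hr
    exact key _ _ (by positivity) hr
  · rw [key (s / 2) s (by positivity) (by linarith), sub_half]
    exact (hD (D f (s / 2)) (s / 2) (by positivity)).2

lemma CurvatureDimension.le (hT : IsMarkovSemigroup T) (hs : IsSymmetricSemigroup T)
    (hd : IsDiffusion T) {lam : ℝ} (hCD : CurvatureDimension T lam) {f Af A2f φ Aφ : Linf μ}
    (hf : HasGenerator T f Af) (hAf : HasGenerator T Af A2f) (hφ0 : 0 ≤ φ)
    (hφ : HasGenerator T φ Aφ) :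
    lam * carreInt T f f φ ≤ carreInt T Af f φ - carreInt T f f Aφ / 2 := by
  have hf' := hf.inDirichletAlgebra hT hs
  have hAf' := hAf.inDirichletAlgebra hT hs
  have h := hCD f Af hf hAf' _ _ _ (hasGamma_carre hd hf' hf') (hasGamma_carre hd hAf' hf')
    (hasGamma_carre hd hf' hAf') φ Aφ hφ0 hφ
  rw [← carreInt_apply, ← carreInt_apply, ← carreInt_apply, ← carreInt_apply,
    carreInt_comm hd hf' hAf'] at h
  linarith

/-- Interpolate with `M(s) = ∫ (T_{v+s} φ) Γ(T_{t+u-s} g)` for `0 ≤ s ≤ t`. The curvature condition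
says `M' ≥ 2 λ M`. The shifts `u, v > 0` keep every orbit at positive times, where it is smooth. -/
lemma gradient_estimate_smooth (hT : IsMarkovSemigroup T) (hs : IsSymmetricSemigroup T)
    (hd : IsDiffusion T) {lam : ℝ} (hCD : CurvatureDimension T lam)
    {c d : ℝ} (hV : VaropoulosBound T c d) (hc : 0 < c) (g : Linf μ) {φ : Linf μ} (hφ : 0 ≤ φ)
    {t u v : ℝ} (ht : 0 ≤ t) (hu : 0 < u) (hv : 0 < v) :
    Real.exp (2 * lam * t) * carreInt T (T (t + u) g) (T (t + u) g) (T v φ)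
      ≤ carreInt T (T u g) (T u g) (T (v + t) φ) := by
  obtain ⟨a, b, hab⟩ := exists_orbit_derivatives hT hs hV hc g
  obtain ⟨p, q, hpq⟩ := exists_orbit_derivatives hT hs hV hc φ
  let F : ℝ → Linf μ := fun s => T (t + u - s) g
  let K : ℝ → Linf μ := fun s => a (t + u - s)
  let B : ℝ → Linf μ := fun s => b (t + u - s)
  let Φ : ℝ → Linf μ := fun s => T (v + s) φ
  let P : ℝ → Linf μ := fun s => p (v + s)
  let Q : ℝ → Linf μ := fun s => q (v + s)
  let M : ℝ → ℝ := fun s =>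
    (expect μ ((Φ s * F s) * K s) + expect μ ((Φ s * F s) * K s) - expect μ ((F s * F s) * P s)) / 2
  have hM : ∀ s, 0 ≤ s → s ≤ t → carreInt T (F s) (F s) (Φ s) = M s := fun s h0 h1 =>
    carreInt_of_hasGenerator hT hs hd (hab (t + u - s) (by linarith)).2.1
      (hab (t + u - s) (by linarith)).2.1 (hpq (v + s) (by linarith)).2.1
  have hM' : ∀ s, 0 ≤ s → s ≤ t → ∃ M', HasDerivAt M M' s ∧ 2 * lam * M s ≤ M' := by
    intro s h0 h1
    obtain ⟨a1, a2, a3, a4⟩ := hab (t + u - s) (by linarith)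
    obtain ⟨p1, p2, p3, p4⟩ := hpq (v + s) (by linarith)
    have e1 : HasDerivAt (fun s : ℝ => t + u - s) (-1) s := by
      simpa using (hasDerivAt_id s).const_sub (t + u)
    have e2 : HasDerivAt (fun s : ℝ => v + s) 1 s := by
      simpa using (hasDerivAt_id s).const_add v
    have dF : HasDerivAt F (K s) s := by simpa using! a1.scomp s e1
    have dK : HasDerivAt K (B s) s := by simpa using! a3.scomp s e1
    have dΦ : HasDerivAt Φ (-(P s)) s := by simpa using! p1.scomp s e2
    have dP : HasDerivAt P (-(Q s)) s := by simpa using! p3.scomp s e2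
    -- Differentiating the product formula for `M` gives `2 ∫ Φ Γ(A F, F) - ∫ (A Φ) Γ(F, F)`, twice
    -- the weak `Γ₂`; `r2` and `r3` expand the two terms for comparison.
    have d1 := (expect μ).hasFDerivAt.comp_hasDerivAt s ((dΦ.linf_mul dF).linf_mul dK)
    have d2 := (expect μ).hasFDerivAt.comp_hasDerivAt s ((dF.linf_mul dF).linf_mul dP)
    refine ⟨_, ((d1.add d1).sub d2).div_const 2, ?_⟩
    have hΦ : 0 ≤ Φ s := hT.nonneg _ (by linarith) _ hφ
    have h := hCD.le hT hs hd a2 a4 hΦ p2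
    have r1 := hM s h0 h1
    have r2 : carreInt T (K s) (F s) (Φ s) = (expect μ ((Φ s * K s) * K s)
        + expect μ ((Φ s * F s) * B s) - expect μ ((K s * F s) * P s)) / 2 :=
      carreInt_of_hasGenerator hT hs hd a4 a2 p2
    have r3 : carreInt T (F s) (F s) (P s) = (expect μ ((P s * F s) * K s)
        + expect μ ((P s * F s) * K s) - expect μ ((F s * F s) * Q s)) / 2 :=
      carreInt_of_hasGenerator hT hs hd a2 a2 p4
    change lam * carreInt T (F s) (F s) (Φ s) ≤ carreInt T (K s) (F s) (Φ s)
      - carreInt T (F s) (F s) (P s) / 2 at h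
    rw [r1, r2, r3] at h
    have s1 : Φ s * F s * B s + (Φ s * K s + -P s * F s) * K s
        = Φ s * F s * B s + Φ s * K s * K s - P s * F s * K s := by ring
    have s2 : F s * F s * -Q s + (F s * K s + K s * F s) * P s
        = P s * F s * K s + P s * F s * K s - F s * F s * Q s := by ring
    have s3 : K s * F s * P s = P s * F s * K s := by ring
    rw [s1, s2]
    rw [s3] at h
    simp only [map_add, map_sub]
    linarith
  have hmono : MonotoneOn (fun s => Real.exp (-(2 * lam * s)) * M s) (Set.Icc 0 t) := by
    have hder : ∀ s ∈ Set.Icc (0:ℝ) t, ∃ D,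
        HasDerivAt (fun s => Real.exp (-(2 * lam * s)) * M s) D s ∧ 0 ≤ D := by
      intro s hs'
      obtain ⟨M', h1, h2⟩ := hM' s hs'.1 hs'.2
      have e1 : HasDerivAt (fun s => -(2 * lam * s)) (-(2 * lam)) s := by
        simpa using! ((hasDerivAt_id s).const_mul (2 * lam)).neg
      refine ⟨_, e1.exp.mul h1, ?_⟩
      have := mul_nonneg (Real.exp_pos (-(2 * lam * s))).le (sub_nonneg.2 h2)
      linarith
    apply monotoneOn_of_deriv_nonneg (convex_Icc 0 t)
    · intro s hs'
      obtain ⟨D, h1, _⟩ := hder s hs'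
      exact h1.continuousAt.continuousWithinAt
    · intro s hs'
      obtain ⟨D, h1, _⟩ := hder s (interior_subset hs')
      exact h1.differentiableAt.differentiableWithinAt
    · intro s hs'
      obtain ⟨D, h1, h2⟩ := hder s (interior_subset hs')
      rwa [h1.deriv]
  have h := hmono (Set.left_mem_Icc.2 ht) (Set.right_mem_Icc.2 ht) ht
  simp only at h
  rw [← hM 0 le_rfl ht, ← hM t ht le_rfl, mul_zero, neg_zero, Real.exp_zero, one_mul] at h
  simp only [F, Φ, sub_zero, add_zero, add_sub_cancel_left] at h
  rwa [Real.exp_neg, inv_mul_eq_div, le_div_iff₀ (Real.exp_pos _), mul_comm] at h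

/-- The gradient estimate `Γ(T_t h) ≤ e^{-2 λ t} T_t Γ(h)` for `h = T_u g`. -/
lemma gradient_estimate (hT : IsMarkovSemigroup T) (hs : IsSymmetricSemigroup T)
    (hd : IsDiffusion T) {lam : ℝ} (hCD : CurvatureDimension T lam)
    {c d : ℝ} (hV : VaropoulosBound T c d) (hc : 0 < c) (g : Linf μ) {φ : Linf μ} (hφ : 0 ≤ φ)
    {t u : ℝ} (ht : 0 ≤ t) (hu : 0 < u) :
    Real.exp (2 * lam * t) * carreInt T (T (t + u) g) (T (t + u) g) φ
      ≤ carreInt T (T u g) (T u g) (T t φ) := by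
  refine le_of_tendsto_of_tendsto ((tendsto_carreInt_map hT _ _ φ).const_mul _)
    (tendsto_carreInt_map hT _ _ (T t φ)) ?_
  filter_upwards [self_mem_nhdsWithin] with v hv
  have hv' : 0 < v := hv
  rw [← hT.add_apply hv'.le ht]
  exact gradient_estimate_smooth hT hs hd hCD hV hc g hφ ht hu hv'

lemma HasGenerator.expect_symm {f g Af Ag : Linf μ} (hT : IsMarkovSemigroup T)
    (hs : IsSymmetricSemigroup T) (hf : HasGenerator T f Af) (hg : HasGenerator T g Ag) :
    expect μ (f * Ag) = expect μ (g * Af) := by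
  rw [expect_mul, expect_mul]
  refine tendsto_nhds_unique (hg.tendsto_expect hT hs f)
    ((hf.tendsto_expect hT hs g).congr' ?_)
  filter_upwards [self_mem_nhdsWithin] with t ht
  rw [mul_sub, mul_sub, map_sub, map_sub, hs.expect_symm (le_of_lt ht), mul_comm g f,
    mul_comm (T t g) f]

/-- Strong continuity of the semigroup in the energy norm. -/
lemma tendsto_energy_map_sub (hT : IsMarkovSemigroup T) (hs : IsSymmetricSemigroup T)
    (hd : IsDiffusion T) {c d : ℝ} (hV : VaropoulosBound T c d) (hc : 0 < c) {g : Linf μ}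
    (hg : InDirichletAlgebra T g) :
    Tendsto (fun u => carreInt T (T u g - g) (T u g - g) 1) (𝓝[>] 0) (𝓝 0) := by
  obtain ⟨a, b, hab⟩ := exists_orbit_derivatives hT hs hV hc g
  -- `ψ(u)` is the energy of `T_u g`, decreasing in `u`. The energy of `T_u g - g` is `ψ(u) - 2
  -- ψ(u/2) + 𝓔(g) ≤ 𝓔(g) - ψ(u/2)`, so it remains to see `ψ(u) → 𝓔(g)`.
  let ψ : ℝ → ℝ := fun u => expect μ (T u g * a u)
  have hTd : ∀ u, 0 < u → InDirichletAlgebra T (T u g) := fun u hu =>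
    (hab u hu).2.1.inDirichletAlgebra hT hs
  have hψ2 : ∀ u, 0 < u → expect μ (g * a u) = ψ (u / 2) := by
    intro u hu
    have e : a u = T (u / 2) (a (u / 2)) := by
      have h1 := (hab u hu).2.1
      have h2 := (hab (u / 2) (by positivity)).2.1.map_linf hT hs (t := u / 2) (by positivity)
      rw [← hT.add_apply (by positivity) (by positivity), add_halves] at h2
      exact h1.unique hT hs h2
    rw [e, hs.expect_symm (by positivity)]
  have hψ : AntitoneOn ψ (Set.Ioi 0) := by
    have hder : ∀ s, 0 < s → HasDerivAt ψ (-(2 * expect μ (a s * a s))) s := by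
      intro s h0
      obtain ⟨a1, a2, a3, a4⟩ := hab s h0
      have h1 := (expect μ).hasFDerivAt.comp_hasDerivAt s (a1.linf_mul a3)
      have e : expect μ (T s g * -b s + -a s * a s) = -(2 * expect μ (a s * a s)) := by
        rw [mul_neg, neg_mul, map_add, map_neg, map_neg, a2.expect_symm hT hs a4]; ring
      rw [e] at h1
      exact h1
    apply antitoneOn_of_deriv_nonpos (convex_Ioi 0)
    · intro s h0
      exact (hder s h0).continuousAt.continuousWithinAt
    · intro s h0
      rw [interior_Ioi] at h0
      exact (hder s h0).differentiableAt.differentiableWithinAt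
    · intro s h0
      rw [interior_Ioi] at h0
      rw [(hder s h0).deriv]
      have := expect_nonneg (linf_mul_self_nonneg (a s))
      linarith
  have hle : ∀ u, 0 < u →
      carreInt T (T u g - g) (T u g - g) 1 ≤ carreInt T g g 1 - ψ (u / 2) := by
    intro u hu
    have e1 := carreInt_expand hT hs hd (hTd u hu) hg (-1) 1
    rw [neg_one_smul, ← sub_eq_add_neg] at e1
    have e2 : carreInt T (T u g) (T u g) 1 = ψ u := by
      rw [carreInt_one_of_hasGenerator hT hs hd (hTd u hu) (hab u hu).2.1, ← expect_mul]
    have e3 : carreInt T (T u g) g 1 = ψ (u / 2) := by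
      rw [carreInt_comm hd (hTd u hu) hg,
        carreInt_one_of_hasGenerator hT hs hd hg (hab u hu).2.1, ← expect_mul, hψ2 u hu]
    have e4 := hψ (Set.mem_Ioi.2 (half_pos hu)) (Set.mem_Ioi.2 hu) (half_le_self hu.le)
    rw [e1, e2, e3]
    linarith
  have hk : ContinuousOn (fun t => expect μ (g * T t g)) (Set.Ici 0) := by
    simp only [expect_mul]
    exact hT.ultraweak_continuous g g (linf_integrable g)
  -- The approximating energies, which converge to `𝓔(g)`, are values of `ψ` at positive times;
  -- monotonicity of `ψ` then bounds it from below near `0`.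
  have hmvt : ∀ u, 0 < u → ∃ ξ, 0 < ξ ∧ expect μ (1 * gammaT T u g g) = ψ (ξ / 2) := by
    intro u hu
    obtain ⟨ξ, hξ, h⟩ := exists_hasDerivAt_eq_slope (fun t => expect μ (g * T t g))
      (fun t => -expect μ (g * a t)) hu (hk.mono Set.Icc_subset_Ici_self)
      (fun x hx => by
        have h1 := (expect μ).hasFDerivAt.comp_hasDerivAt x
          ((hasDerivAt_const x g).linf_mul (hab x hx.1).1)
        simpa using! h1)
    refine ⟨ξ, hξ.1, ?_⟩
    rw [one_mul, expect_gammaT hT hs hu.le, ← hψ2 ξ hξ.1, mul_sub, map_sub]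
    rw [hT.zero_apply, sub_zero, eq_div_iff hu.ne'] at h
    rw [inv_mul_eq_div, div_eq_iff hu.ne']
    linarith
  have hE := tendsto_carreInt hd hg hg 1
  rw [Metric.tendsto_nhds]
  intro ε hε
  have h1 := hE.eventually (lt_mem_nhds (sub_lt_self (carreInt T g g 1) hε))
  obtain ⟨u, hu1, hu2⟩ := (h1.and self_mem_nhdsWithin).exists
  obtain ⟨ξ, hξ, h2⟩ := hmvt u hu2
  rw [h2] at hu1
  filter_upwards [Ioo_mem_nhdsGT hξ] with w hw
  have hw0 : 0 < w := hw.1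
  have h3 := hψ (Set.mem_Ioi.2 (half_pos hw0)) (Set.mem_Ioi.2 (half_pos hξ))
    (by linarith [hw.2] : w / 2 ≤ ξ / 2)
  have h4 := hle w hw0
  have h5 := carreInt_self_nonneg hT hd ((hTd w hw0).sub hT hs hg) (linf_one_nonneg (μ := μ))
  rw [Real.dist_eq, sub_zero, abs_of_nonneg h5]
  linarith

lemma carreInt_self_mono (hT : IsMarkovSemigroup T) (hd : IsDiffusion T) {f : Linf μ}
    (hf : InDirichletAlgebra T f) {φ φ' : Linf μ} (h : φ ≤ φ') :
    carreInt T f f φ ≤ carreInt T f f φ' := by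
  have := carreInt_self_nonneg hT hd hf (sub_nonneg.2 h)
  rw [map_sub] at this; linarith

/-- With `r = T_u g - g`, use `Γ(g + r) ≤ (1 + κ) Γ(g) + (1 + κ⁻¹) Γ(r)`. A small `κ` spends half of
`δ`; energy continuity makes the last term fit in the other half. -/
lemma eventually_carreInt_map_le (hT : IsMarkovSemigroup T) (hs : IsSymmetricSemigroup T)
    (hd : IsDiffusion T) {c d : ℝ} (hV : VaropoulosBound T c d) (hc : 0 < c) {g w : Linf μ}
    (hg : InDirichletAlgebra T g) (hw : 0 ≤ w) {δ : ℝ} (hδ : 0 < δ) :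
    ∀ᶠ u in 𝓝[>] 0, carreInt T (T u g) (T u g) w ≤ carreInt T g g w + δ := by
  have hgg := carreInt_self_nonneg hT hd hg hw
  set κ : ℝ := δ / (2 * (carreInt T g g w + 1)) with hκdef
  have hκ : 0 < κ := by positivity
  have hκ1 : κ * carreInt T g g w ≤ δ / 2 := by
    rw [hκdef, div_mul_eq_mul_div, div_le_iff₀ (by positivity)]
    nlinarith
  have h1 := (tendsto_energy_map_sub hT hs hd hV hc hg).const_mul ((1 + κ⁻¹) * ‖w‖)
  rw [mul_zero] at h1
  filter_upwards [h1.eventually (gt_mem_nhds (half_pos hδ)), self_mem_nhdsWithin] with u hu hu0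
  have hu0' : 0 < u := hu0
  obtain ⟨D, _, hD⟩ := exists_hasDerivAt_hasGenerator hT hs hV hc g hu0'
  have hr : InDirichletAlgebra T (T u g - g) := (hD.inDirichletAlgebra hT hs).sub hT hs hg
  have e := carreInt_expand hT hs hd hg hr 1 w
  rw [one_smul, add_sub_cancel] at e
  have h2 := two_mul_carreInt_le hT hs hd hg hr hw hκ
  have h3 := carreInt_self_mono hT hd hr (linf_le_norm_smul_one w)
  rw [map_smul, smul_eq_mul] at h3
  have h4 : (1 + κ⁻¹) * carreInt T (T u g - g) (T u g - g) w
      ≤ (1 + κ⁻¹) * (‖w‖ * carreInt T (T u g - g) (T u g - g) 1) := by gcongr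
  rw [e]
  nlinarith

end GradientEstimate

/-! ### Decay of the Fisher information -/

section Fisher

variable {T : ℝ → Linf μ →L[ℝ] Linf μ}

lemma ae_le_map (hT : IsMarkovSemigroup T) {ρ : Linf μ} {a : ℝ} (ha : ∀ᵐ x ∂μ, a ≤ ρ x) {t : ℝ}
    (ht : 0 ≤ t) : ∀ᵐ x ∂μ, a ≤ T t ρ x := by
  have h1 : a • (1 : Linf μ) ≤ ρ := by
    rw [← Lp.coeFn_le]
    filter_upwards [ha, coeFn_smul_one (μ := μ) a] with x h1 h2
    rwa [h2]
  have h2 := hT.mono ht h1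
  rw [map_smul, hT.map_one ht, ← Lp.coeFn_le] at h2
  filter_upwards [h2, coeFn_smul_one (μ := μ) a] with x h3 h4
  rwa [h4] at h3

lemma map_ae_le (hT : IsMarkovSemigroup T) {ρ : Linf μ} {b : ℝ} (hb : ∀ᵐ x ∂μ, ρ x ≤ b) {t : ℝ}
    (ht : 0 ≤ t) : ∀ᵐ x ∂μ, T t ρ x ≤ b := by
  have h1 : ρ ≤ b • (1 : Linf μ) := by
    rw [← Lp.coeFn_le]
    filter_upwards [hb, coeFn_smul_one (μ := μ) b] with x h1 h2
    rwa [h2]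
  have h2 := hT.mono ht h1
  rw [map_smul, hT.map_one ht, ← Lp.coeFn_le] at h2
  filter_upwards [h2, coeFn_smul_one (μ := μ) b] with x h3 h4
  rwa [h4] at h3

lemma abs_log_le {a b y : ℝ} (ha : 0 < a) (h1 : a ≤ y) (h2 : y ≤ b) :
    |Real.log y| ≤ |Real.log a| + |Real.log b| := by
  have h3 := Real.log_le_log ha h1
  have h4 := Real.log_le_log (ha.trans_le h1) h2
  rw [abs_le]
  constructor
  · linarith [neg_abs_le (Real.log a), abs_nonneg (Real.log b)]
  · linarith [le_abs_self (Real.log b), abs_nonneg (Real.log a)]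

lemma exists_log {ρ : Linf μ} {a : ℝ} (ha : 0 < a) (h : ∀ᵐ x ∂μ, a ≤ ρ x) :
    ∃ g : Linf μ, ∀ᵐ x ∂μ, g x = Real.log (ρ x) :=
  exists_linf (C := |Real.log a| + |Real.log ‖ρ‖|)
    (Real.measurable_log.comp_aemeasurable (Lp.memLp ρ).1.aemeasurable).aestronglyMeasurable (by
      filter_upwards [h, linf_ae_abs_le ρ] with x h1 h2
      exact abs_log_le ha h1 ((le_abs_self _).trans h2))

lemma InDirichletAlgebra.log (hT : IsMarkovSemigroup T) (hs : IsSymmetricSemigroup T)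
    {ρ g : Linf μ} (hρ : InDirichletAlgebra T ρ) {a : ℝ} (ha : 0 < a) (h : ∀ᵐ x ∂μ, a ≤ ρ x)
    (hg : ∀ᵐ x ∂μ, g x = Real.log (ρ x)) : InDirichletAlgebra T g := by
  have hl : LipschitzOnWith (a⁻¹).toNNReal Real.log (Set.Ici a) := by
    apply (convex_Ici a).lipschitzOnWith_of_nnnorm_hasDerivWithin_le (f' := fun y => y⁻¹)
      (fun y hy => (Real.hasDerivAt_log (ha.trans_le hy).ne').hasDerivWithinAt)
    intro y hy
    rw [← NNReal.coe_le_coe, coe_nnnorm, Real.norm_eq_abs, abs_inv,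
      abs_of_pos (ha.trans_le hy), Real.coe_toNNReal _ (by positivity)]
    exact inv_anti₀ ha hy
  obtain ⟨ψ, h1, h2⟩ := hl.extend_real
  refine hρ.comp hT hs h1 ?_
  filter_upwards [h, hg] with x h3 h4
  rw [h4]; exact h2 h3

/-- The Fisher information as an integral of the gradient form. -/
lemma fisher_eq (hT : IsMarkovSemigroup T) (hs : IsSymmetricSemigroup T) (hd : IsDiffusion T)
    {ρ g : Linf μ} {Aρ : Ω → ℝ} (hρ : HasGenerator T ρ Aρ) {a : ℝ} (ha : 0 < a)
    (h : ∀ᵐ x ∂μ, a ≤ ρ x) (hg : ∀ᵐ x ∂μ, g x = Real.log (ρ x)) {w : Linf μ}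
    (hw : InDirichletAlgebra T w) : ∫ x, w x * Aρ x ∂μ = carreInt T g w ρ := by
  have hρ' := hρ.inDirichletAlgebra hT hs
  rw [← carreInt_one_of_hasGenerator hT hs hd hw hρ, carreInt_comm hd hw hρ']
  refine carreInt_exp hT hs hd (hρ'.log hT hs ha h hg) hw hρ' ?_
  filter_upwards [h, hg] with x h1 h2
  rw [h2, Real.exp_log (ha.trans_le h1)]

lemma HasGenerator.integral_map {ρ w : Linf μ} {Aρ B : Ω → ℝ} (hT : IsMarkovSemigroup T)
    (hs : IsSymmetricSemigroup T) (hρ : HasGenerator T ρ Aρ) {t : ℝ} (ht : 0 ≤ t)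
    (hB : HasGenerator T (T t ρ) B) : ∫ x, w x * B x ∂μ = ∫ x, T t w x * Aρ x ∂μ := by
  refine tendsto_nhds_unique (hB.tendsto_expect hT hs w)
    ((hρ.tendsto_expect hT hs (T t w)).congr' ?_)
  filter_upwards [self_mem_nhdsWithin] with s hs'
  have h0 : 0 ≤ s := le_of_lt hs'
  rw [← hs.expect_symm ht, map_sub, ← hT.add_apply ht h0, ← hT.add_apply h0 ht, add_comm]

/-- Exponential decay of the Fisher information along the semigroup. -/
lemma fisher_decay (hT : IsMarkovSemigroup T) (hs : IsSymmetricSemigroup T)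
    (hd : IsDiffusion T) {lam : ℝ} (hCD : CurvatureDimension T lam)
    {c d : ℝ} (hV : VaropoulosBound T c d) (hc : 0 < c) {ρ g g₀ : Linf μ} {Aρ B : Ω → ℝ} {a : ℝ}
    (ha : 0 < a) (h : ∀ᵐ x ∂μ, a ≤ ρ x) (hρ : HasGenerator T ρ Aρ) {t : ℝ} (ht : 0 ≤ t)
    (hB : HasGenerator T (T t ρ) B) (hg : ∀ᵐ x ∂μ, g x = Real.log (T t ρ x))
    (hg₀ : ∀ᵐ x ∂μ, g₀ x = Real.log (ρ x)) :
    ∫ x, g x * B x ∂μ ≤ Real.exp (-(2 * lam * t)) * ∫ x, g₀ x * Aρ x ∂μ := by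
  have hat := ae_le_map hT h ht
  have hgd := (hB.inDirichletAlgebra hT hs).log hT hs ha hat hg
  have hg₀d := (hρ.inDirichletAlgebra hT hs).log hT hs ha h hg₀
  have hρ0 : 0 ≤ ρ := linf_nonneg_iff.2 (by filter_upwards [h] with x hx; linarith)
  have hρt0 : 0 ≤ T t ρ := hT.nonneg t ht _ hρ0
  rw [fisher_eq hT hs hd hρ ha h hg₀ hg₀d]
  have hJ := fisher_eq hT hs hd hB ha hat hg hgd
  -- The Cauchy–Schwarz weight `e^{-2 λ t}` is the one whose inverse cancels the factor from the
  -- gradient estimate. The shift by `u` is required because that estimate covers only `T_u g`.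
  have hstep : ∀ u, 0 < u → 2 * ∫ x, T u g x * B x ∂μ
      ≤ Real.exp (-(2 * lam * t)) * carreInt T g₀ g₀ ρ
        + carreInt T (T u g) (T u g) (T t ρ) := by
    intro u hu
    obtain ⟨D, _, hD⟩ := exists_hasDerivAt_hasGenerator hT hs hV hc g (t := t + u) (by linarith)
    have hDd := hD.inDirichletAlgebra hT hs
    rw [hρ.integral_map hT hs ht hB, ← hT.add_apply ht hu.le,
      fisher_eq hT hs hd hρ ha h hg₀ hDd]
    have h1 := two_mul_carreInt_le hT hs hd hg₀d hDd hρ0 (Real.exp_pos (-(2 * lam * t)))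
    rw [← Real.exp_neg, neg_neg] at h1
    have h2 := gradient_estimate hT hs hd hCD hV hc g hρ0 ht hu
    linarith
  have hlim : Tendsto (fun u => ∫ x, T u g x * B x ∂μ) (𝓝[>] 0) (𝓝 (∫ x, g x * B x ∂μ)) := by
    have hBi : Integrable B μ := hB.1.integrable (by norm_num)
    have h1 := (hT.ultraweak_continuous g B hBi 0 (Set.mem_Ici.2 le_rfl)).tendsto.mono_left
      (nhdsWithin_mono 0 Set.Ioi_subset_Ici_self)
    simp only [hT.zero_apply] at h1
    simpa only [mul_comm] using h1
  apply le_of_forall_pos_le_add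
  intro δ hδ
  have h1 : 2 * ∫ x, g x * B x ∂μ
      ≤ Real.exp (-(2 * lam * t)) * carreInt T g₀ g₀ ρ + (carreInt T g g (T t ρ) + δ) := by
    refine le_of_tendsto (hlim.const_mul 2) ?_
    filter_upwards [self_mem_nhdsWithin, eventually_carreInt_map_le hT hs hd hV hc hgd hρt0 hδ]
      with u hu1 hu2
    exact (hstep u hu1).trans (by linarith)
  -- As `u → 0` the left side is `2 I(T_t ρ)`, and the right side contains `I(T_t ρ)` once, which is
  -- absorbed.
  rw [← hJ] at h1
  linarith

end Fisher

/-! ### Entropy along the semigroup -/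

section Entropy

variable {T : ℝ → Linf μ →L[ℝ] Linf μ}

/-- Convexity of `y log y` in the form of its tangent at `y`. It serves for entropy differences, for
Jensen's inequality and for the midpoint inequality. -/
lemma mul_log_sub_le {y z : ℝ} (hy : 0 < y) (hz : 0 < z) :
    y * Real.log y - z * Real.log z ≤ (Real.log y + 1) * (y - z) := by
  have h := Real.log_le_sub_one_of_pos (div_pos hy hz)
  rw [Real.log_div hy.ne' hz.ne'] at h
  have h2 := mul_le_mul_of_nonneg_left h hz.le
  have e : z * (y / z - 1) = y - z := by field_simp
  rw [e] at h2
  nlinarith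

lemma linf_mul_log_integrable {ρ : Linf μ} {a : ℝ} (ha : 0 < a) (h : ∀ᵐ x ∂μ, a ≤ ρ x) :
    Integrable (fun x => ρ x * Real.log (ρ x)) μ := by
  obtain ⟨g, hg⟩ := exists_log ha h
  refine (linf_mul_integrable ρ (linf_integrable g)).congr ?_
  filter_upwards [hg] with x hx
  rw [hx]

/-- The derivative of `y log y` is `log y + 1`; the `1` integrates to zero because the masses agree.
-/
lemma entropy_sub_le {ρ η g : Linf μ} {a : ℝ} (ha : 0 < a) (h : ∀ᵐ x ∂μ, a ≤ ρ x)
    (h' : ∀ᵐ x ∂μ, a ≤ η x) (hg : ∀ᵐ x ∂μ, g x = Real.log (ρ x))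
    (he : expect μ ρ = expect μ η) :
    ∫ x, ρ x * Real.log (ρ x) ∂μ - ∫ x, η x * Real.log (η x) ∂μ ≤ expect μ (g * (ρ - η)) := by
  rw [← integral_sub (linf_mul_log_integrable ha h) (linf_mul_log_integrable ha h')]
  have e : expect μ (g * (ρ - η)) = expect μ ((g + 1) * (ρ - η)) := by
    rw [add_mul, map_add, one_mul, map_sub _ ρ, he]; simp
  rw [e, expect_apply]
  apply integral_mono_ae ((linf_mul_log_integrable ha h).sub (linf_mul_log_integrable ha h'))
    (linf_integrable _)
  filter_upwards [h, h', hg, coeFn_mul (g + 1) (ρ - η), Lp.coeFn_add g 1, Lp.coeFn_sub ρ η,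
    coeFn_one (μ := μ)] with x h1 h2 h3 h4 h5 h6 h7
  rw [h4, h5, h6, Pi.add_apply, Pi.sub_apply, h3, h7]
  exact mul_log_sub_le (ha.trans_le h1) (ha.trans_le h2)

lemma continuous_entropy (hT : IsMarkovSemigroup T) (hs : IsSymmetricSemigroup T)
    {ρ : Linf μ} {a : ℝ} (ha : 0 < a) (h : ∀ᵐ x ∂μ, a ≤ ρ x) :
    ContinuousOn (fun t => ∫ x, T t ρ x * Real.log (T t ρ x) ∂μ) (Set.Ici 0) := by
  set C := |Real.log a| + |Real.log ‖ρ‖|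
  have hC : 0 ≤ C := by positivity
  have key : ∀ s t, 0 ≤ s → 0 ≤ t →
      ∫ x, T s ρ x * Real.log (T s ρ x) ∂μ - ∫ x, T t ρ x * Real.log (T t ρ x) ∂μ
        ≤ C * ‖toL2 μ (T s ρ) - toL2 μ (T t ρ)‖ := by
    intro s t h0 h1
    obtain ⟨g, hg⟩ := exists_log ha (ae_le_map hT h h0)
    refine (entropy_sub_le ha (ae_le_map hT h h0) (ae_le_map hT h h1) hg
      (by rw [expect_map hT hs h0, expect_map hT hs h1])).trans ?_
    rw [← map_sub]
    refine le_trans ?_ (mul_le_mul_of_nonneg_left (expect_abs_le_norm_toL2 _) hC)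
    rw [expect_mul, ← integral_const_mul]
    apply integral_mono_ae (linf_mul_integrable _ (linf_integrable _))
      ((linf_integrable _).abs.const_mul C)
    have hb : ∀ᵐ x ∂μ, ρ x ≤ ‖ρ‖ := by
      filter_upwards [linf_ae_abs_le ρ] with x hx using (le_abs_self _).trans hx
    filter_upwards [hg, ae_le_map hT h h0, map_ae_le hT hb h0] with x h1 h2 h3
    refine (le_abs_self _).trans ?_
    rw [abs_mul, h1]
    exact mul_le_mul_of_nonneg_right (abs_log_le ha h2 h3) (abs_nonneg _)
  intro t ht
  have ht' : (0:ℝ) ≤ t := ht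
  rw [ContinuousWithinAt, tendsto_iff_dist_tendsto_zero]
  have hc : Tendsto (fun s => C * ‖toL2 μ (T (max s 0) ρ) - toL2 μ (T (max t 0) ρ)‖)
      (𝓝[Set.Ici 0] t) (𝓝 0) := by
    have h1 := tendsto_iff_norm_sub_tendsto_zero.1
      ((continuous_toL2_map hT hs ρ).tendsto t)
    simpa using (h1.const_mul C).mono_left nhdsWithin_le_nhds
  refine squeeze_zero' (Eventually.of_forall fun _ => dist_nonneg) ?_ hc
  filter_upwards [self_mem_nhdsWithin] with s hs'
  have hs0 : (0:ℝ) ≤ s := hs'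
  rw [max_eq_left hs0, max_eq_left ht', Real.dist_eq, abs_le]
  constructor
  · have := key t s ht' hs0
    rw [norm_sub_rev] at this
    linarith
  · exact key s t hs0 ht'

/-- The entropy production is controlled by the initial Fisher information. -/
lemma entropy_sub_le_fisher (hT : IsMarkovSemigroup T) (hs : IsSymmetricSemigroup T)
    (hd : IsDiffusion T) {lam : ℝ} (hCD : CurvatureDimension T lam)
    {c d : ℝ} (hV : VaropoulosBound T c d) (hc : 0 < c) {ρ : Linf μ} {Aρ : Ω → ℝ} {a : ℝ}
    (ha : 0 < a) (h : ∀ᵐ x ∂μ, a ≤ ρ x) (hρ : HasGenerator T ρ Aρ) {κ : ℝ → ℝ} (hκ0 : κ 0 = 0)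
    (hκ : ∀ s, HasDerivAt κ (Real.exp (-(2 * lam * s))) s) {t : ℝ} (ht : 0 ≤ t) :
    ∫ x, ρ x * Real.log (ρ x) ∂μ - ∫ x, T t ρ x * Real.log (T t ρ x) ∂μ
      ≤ κ t * ∫ x, Aρ x * Real.log (ρ x) ∂μ := by
  obtain ⟨g₀, hg₀⟩ := exists_log ha h
  have hI : ∫ x, Aρ x * Real.log (ρ x) ∂μ = ∫ x, g₀ x * Aρ x ∂μ := by
    apply integral_congr_ae
    filter_upwards [hg₀] with x hx
    rw [hx, mul_comm]
  rw [hI]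
  set I₀ := ∫ x, g₀ x * Aρ x ∂μ
  let D : ℝ → ℝ := fun s => ∫ x, T s ρ x * Real.log (T s ρ x) ∂μ
  have hB : ∀ s, HasDerivAt (fun s => -D 0 + κ s * I₀) (Real.exp (-(2 * lam * s)) * I₀) s :=
    fun s => ((hκ s).mul_const I₀).const_add _
  -- Differentiability of the entropy is not needed: `entropy_sub_le` bounds its right slopes by
  -- quotients converging to `I(T_s ρ)`, and `fisher_decay` bounds this by `κ'(s) I(ρ)`.
  have key := image_le_of_liminf_slope_right_le_deriv_boundary (f := fun s => -D s)
    (B := fun s => -D 0 + κ s * I₀) (B' := fun s => Real.exp (-(2 * lam * s)) * I₀)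
    (a := 0) (b := t)
    (((continuous_entropy hT hs ha h).mono Set.Icc_subset_Ici_self).neg)
    (by simp [hκ0])
    (fun s _ => (hB s).continuousAt.continuousWithinAt)
    (fun s _ => (hB s).hasDerivWithinAt)
    (by
      intro s hs' r hr
      have hs0 : 0 ≤ s := hs'.1
      have has := ae_le_map hT h hs0
      obtain ⟨g, hg⟩ := exists_log ha has
      obtain ⟨B, hBg⟩ : ∃ B : Ω → ℝ, HasGenerator T (T s ρ) B := by
        have h1 := (isSymmContractionSemigroup hT hs).isGen_map
          ((hasGenerator_iff_toLp hT hs hρ.1).1 hρ) hs0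
        rw [l2Semigroup_toL2_of_nonneg hT hs hs0] at h1
        exact ⟨_, (hasGenerator_iff hT hs).2 h1⟩
      have hdec := fisher_decay hT hs hd hCD hV hc ha h hρ hs0 hBg hg hg₀
      have hlim := hBg.tendsto_expect hT hs g
      have hev := hlim.eventually (gt_mem_nhds (hdec.trans_lt hr))
      have hsh : Tendsto (fun z : ℝ => z - s) (𝓝[>] s) (𝓝[>] 0) := by
        refine tendsto_nhdsWithin_iff.2 ⟨?_, ?_⟩
        · have : Tendsto (fun y : ℝ => y - s) (𝓝 s) (𝓝 (s - s)) :=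
            (continuous_id.sub continuous_const).tendsto s
          rw [sub_self] at this
          exact this.mono_left nhdsWithin_le_nhds
        · filter_upwards [self_mem_nhdsWithin] with y hy
          simpa using hy
      apply Eventually.frequently
      filter_upwards [hsh.eventually hev, self_mem_nhdsWithin] with z hz1 hz2
      have hz : s < z := hz2
      refine lt_of_le_of_lt ?_ hz1
      have e : T z ρ = T (z - s) (T s ρ) := by
        rw [← hT.add_apply (by linarith) hs0]; congr 2; ring
      have h3 := entropy_sub_le ha has (ae_le_map hT h (hs0.trans hz.le)) hg
        (by rw [expect_map hT hs hs0, expect_map hT hs (hs0.trans hz.le)])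
      rw [slope_def_field, div_eq_inv_mul, ← e]
      apply mul_le_mul_of_nonneg_left _ (inv_nonneg.2 (by linarith))
      simp only [D]
      linarith)
  have h1 := key (Set.right_mem_Icc.2 ht)
  simp only [D, hT.zero_apply] at h1
  linarith

/-- Positive unital maps that preserve the expectation do not increase the entropy. -/
lemma entropy_map_le {P : Linf μ →L[ℝ] Linf μ} (hP : ∀ f, 0 ≤ f → 0 ≤ P f) (h1 : P 1 = 1)
    (hE : ∀ f, expect μ (P f) = expect μ f) {ρ : Linf μ} {a : ℝ} (ha : 0 < a)
    (h : ∀ᵐ x ∂μ, a ≤ ρ x) (h' : ∀ᵐ x ∂μ, a ≤ P ρ x) :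
    ∫ x, P ρ x * Real.log (P ρ x) ∂μ ≤ ∫ x, ρ x * Real.log (ρ x) ∂μ := by
  obtain ⟨g, hg⟩ := exists_log ha h
  have e : ∫ x, ρ x * Real.log (ρ x) ∂μ = ∫ x, P (ρ * g) x ∂μ := by
    rw [← expect_apply, hE, expect_mul]
    apply integral_congr_ae
    filter_upwards [hg] with x hx
    rw [hx]
  rw [e]
  -- Jensen by duality: apply `P` to `ρ log ρ ≥ (r + 1) ρ - e^r`, then substitute the optimal `r =
  -- log (P ρ)(x)`.
  have key : ∀ᵐ x ∂μ, ∀ r : ℝ, 0 ≤ P (ρ * g) x - r * P ρ x - P ρ x + Real.exp r := by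
    apply ae_forall_nonneg (fun x => by fun_prop)
    intro r
    have h0 : 0 ≤ ρ * g - (r + 1) • ρ + (Real.exp r) • (1 : Linf μ) := by
      rw [linf_nonneg_iff]
      filter_upwards [h, hg, coeFn_mul ρ g, Lp.coeFn_smul (r + 1) ρ,
        Lp.coeFn_sub (ρ * g) ((r + 1) • ρ), coeFn_smul_one (μ := μ) (Real.exp r),
        Lp.coeFn_add (ρ * g - (r + 1) • ρ) ((Real.exp r) • (1 : Linf μ))]
        with x h1 h2 h3 h4 h5 h6 h7
      rw [h7, Pi.add_apply, h5, Pi.sub_apply, h3, h4, h6, Pi.smul_apply, h2, smul_eq_mul]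
      have := mul_log_sub_le (Real.exp_pos r) (ha.trans_le h1)
      rw [Real.log_exp] at this
      nlinarith
    have h2 := hP _ h0
    rw [map_add, map_sub, map_smul, map_smul, h1, linf_nonneg_iff] at h2
    filter_upwards [h2, Lp.coeFn_smul (r + 1) (P ρ), Lp.coeFn_sub (P (ρ * g)) ((r + 1) • P ρ),
      coeFn_smul_one (μ := μ) (Real.exp r),
      Lp.coeFn_add (P (ρ * g) - (r + 1) • P ρ) ((Real.exp r) • (1 : Linf μ))]
      with x h1 h2 h3 h4 h5
    rw [h5, Pi.add_apply, h3, Pi.sub_apply, h2, h4, Pi.smul_apply, smul_eq_mul] at h1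
    linarith
  apply integral_mono_ae (linf_mul_log_integrable ha h') (linf_integrable _)
  filter_upwards [key, h'] with x h2 h3
  have h4 := h2 (Real.log (P ρ x))
  rw [Real.exp_log (ha.trans_le h3)] at h4
  linarith

/-- A Markov operator that dominates half of the expectation halves the entropy. -/
lemma entropy_half {P : Linf μ →L[ℝ] Linf μ} (hP : ∀ f, 0 ≤ f → (expect μ f / 2) • 1 ≤ P f)
    (h1 : P 1 = 1) (hE : ∀ f, expect μ (P f) = expect μ f) {ρ : Linf μ} {a : ℝ} (ha : 0 < a)
    (h : ∀ᵐ x ∂μ, a ≤ ρ x) (hρ : expect μ ρ = 1) :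
    ∫ x, P ρ x * Real.log (P ρ x) ∂μ ≤ (∫ x, ρ x * Real.log (ρ x) ∂μ) / 2 := by
  -- `Q` is again positive, unital and expectation preserving, and `P ρ = (1 + Q ρ) / 2`. The
  -- constant `1` has zero entropy and `Q` does not increase entropy, so convexity yields the factor
  -- `1/2`.
  let Q : Linf μ →L[ℝ] Linf μ := (2 : ℝ) • P - (expect μ).smulRight (1 : Linf μ)
  have hQ : ∀ f, Q f = (2 : ℝ) • P f - expect μ f • (1 : Linf μ) := fun f => rfl
  have hQ0 : ∀ f, 0 ≤ f → 0 ≤ Q f := by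
    intro f hf
    have := hP f hf
    rw [← Lp.coeFn_le] at this
    rw [linf_nonneg_iff, hQ]
    filter_upwards [this, Lp.coeFn_smul (2:ℝ) (P f), coeFn_smul_one (μ := μ) (expect μ f),
      coeFn_smul_one (μ := μ) (expect μ f / 2),
      Lp.coeFn_sub ((2 : ℝ) • P f) (expect μ f • (1 : Linf μ))] with x h1 h2 h3 h4 h5
    rw [h5, Pi.sub_apply, h2, h3, Pi.smul_apply, smul_eq_mul]
    rw [h4] at h1
    linarith
  have hQ1 : Q 1 = 1 := by rw [hQ, h1, expect_one]; module
  have hQE : ∀ f, expect μ (Q f) = expect μ f := fun f => by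
    rw [hQ, map_sub, map_smul, map_smul, hE, expect_one, smul_eq_mul, smul_eq_mul]; ring
  have hQa : ∀ᵐ x ∂μ, a ≤ Q ρ x := by
    have h2 : 0 ≤ ρ - a • (1 : Linf μ) := by
      rw [sub_nonneg, ← Lp.coeFn_le]
      filter_upwards [h, coeFn_smul_one (μ := μ) a] with x h1 h2
      rwa [h2]
    have h3 := hQ0 _ h2
    rw [map_sub, map_smul, hQ1, sub_nonneg, ← Lp.coeFn_le] at h3
    filter_upwards [h3, coeFn_smul_one (μ := μ) a] with x h3 h4
    rwa [h4] at h3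
  have hlow : ∀ᵐ x ∂μ, P ρ x = (1 + Q ρ x) / 2 := by
    rw [hQ, hρ]
    filter_upwards [Lp.coeFn_smul (2:ℝ) (P ρ), coeFn_smul_one (μ := μ) 1,
      Lp.coeFn_sub ((2 : ℝ) • P ρ) ((1 : ℝ) • (1 : Linf μ))] with x h1 h2 h3
    rw [h3, Pi.sub_apply, h1, h2, Pi.smul_apply, smul_eq_mul]; ring
  have hPa : ∀ᵐ x ∂μ, 1 / 2 ≤ P ρ x := by
    filter_upwards [hlow, hQa] with x h1 h2
    rw [h1]; linarith
  have h3 := entropy_map_le hQ0 hQ1 hQE ha h hQa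
  refine le_trans ?_ (div_le_div_of_nonneg_right h3 (by norm_num))
  rw [← integral_div]
  apply integral_mono_ae (linf_mul_log_integrable (by norm_num) hPa)
    ((linf_mul_log_integrable ha hQa).div_const 2)
  filter_upwards [hlow, hQa] with x h1 h2
  have hq : 0 < Q ρ x := ha.trans_le h2
  have hm : 0 < (1 + Q ρ x) / 2 := by positivity
  have c1 := mul_log_sub_le hm one_pos
  have c2 := mul_log_sub_le hm hq
  simp only [h1]
  rw [Real.log_one, mul_zero, sub_zero] at c1
  linarith

end Entropy

/-! ### Mixing from ultracontractivity and the spectral gap -/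

section Gap

variable {T : ℝ → Linf μ →L[ℝ] Linf μ}

lemma norm_toL2_eq (f : Linf μ) : ‖toL2 μ f‖ = (eLpNorm f 2 μ).toReal := by
  rw [Lp.norm_def, eLpNorm_congr_ae (coeFn_toL2 f)]

lemma HasSpectralGap.le {σ : ℝ} (hσ : 0 < σ) (hgap : HasSpectralGap T σ) {f g : Linf μ}
    (h : HasGenerator T f g) (hf : expect μ f = 0) : σ * ‖toL2 μ f‖ ≤ ‖toL2 μ g‖ := by
  have h1 := hgap f g h
  rw [← expect_apply, hf] at h1
  simp only [sub_zero] at h1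
  have h2 := ENNReal.toReal_mono
    (ENNReal.mul_ne_top ENNReal.ofReal_ne_top h.1.2.ne) h1
  rw [ENNReal.toReal_mul, ENNReal.toReal_ofReal (by positivity), ← norm_toL2_eq,
    ← norm_toL2_eq] at h2
  rwa [← le_inv_mul_iff₀ hσ]

/-- Exponential decay in `L_2` of centered functions in the domain of the generator. -/
lemma norm_toL2_map_le_exp (hT : IsMarkovSemigroup T) (hs : IsSymmetricSemigroup T) {σ : ℝ}
    (hσ : 0 < σ) (hgap : HasSpectralGap T σ) {f g : Linf μ} (h : HasGenerator T f g)
    (hf : expect μ f = 0) {t : ℝ} (ht : 0 ≤ t) :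
    ‖toL2 μ (T t f)‖ ≤ Real.exp (-(σ * t)) * ‖toL2 μ f‖ := by
  have h1 := (isSymmContractionSemigroup hT hs).norm_le_exp_of_gap
    ((hasGenerator_iff_toL2 hT hs).1 h) hσ (fun s h0 => by
      rw [l2Semigroup_toL2_of_nonneg hT hs h0, l2Semigroup_toL2_of_nonneg hT hs h0]
      exact hgap.le hσ (h.map_linf hT hs h0) (by rw [expect_map hT hs h0, hf])) ht
  rwa [l2Semigroup_toL2_of_nonneg hT hs ht] at h1

lemma HasGenerator.sub_const (hT : IsMarkovSemigroup T) (hs : IsSymmetricSemigroup T)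
    {f g : Linf μ} (h : HasGenerator T f g) (a : ℝ) :
    HasGenerator T (f - a • (1 : Linf μ)) g := by
  rw [hasGenerator_iff_toL2 hT hs] at h ⊢
  refine h.congr' ?_
  filter_upwards [self_mem_nhdsWithin] with t ht
  have ht' : 0 ≤ t := le_of_lt ht
  rw [l2Semigroup_toL2_of_nonneg hT hs ht', l2Semigroup_toL2_of_nonneg hT hs ht', ← map_sub,
    ← map_sub, map_sub (T t), map_smul, hT.map_one ht']
  congr 2
  abel

lemma expect_abs {f : Linf μ} (hf : 0 ≤ f) : ∫ x, |f x| ∂μ = expect μ f := by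
  rw [expect_apply]
  apply integral_congr_ae
  filter_upwards [linf_nonneg_iff.1 hf] with x hx
  exact abs_of_nonneg hx

/-- The centered function `T_{1/4} f - ∫ f` and its generator. -/
lemma exists_centered (hT : IsMarkovSemigroup T) (hs : IsSymmetricSemigroup T)
    {c d : ℝ} (hV : VaropoulosBound T c d) (hc : 0 < c) {f : Linf μ} (hf : 0 ≤ f) :
    ∃ g : Linf μ, HasGenerator T (T (1 / 4) f - expect μ f • (1 : Linf μ)) g ∧
      expect μ (T (1 / 4) f - expect μ f • (1 : Linf μ)) = 0 ∧
      ‖toL2 μ (T (1 / 4) f - expect μ f • (1 : Linf μ))‖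
        ≤ √(c * (1 / 2) ^ (-(d / 2))) * expect μ f := by
  obtain ⟨g, _, hg⟩ := exists_hasDerivAt_hasGenerator hT hs hV hc f (t := 1 / 4) (by norm_num)
  have hE := expect_map hT hs (t := 1 / 4) (by norm_num) f
  refine ⟨g, hg.sub_const hT hs _, ?_, ?_⟩
  · rw [map_sub, map_smul, hE, expect_one, smul_eq_mul, mul_one, sub_self]
  · have hf0 := expect_nonneg hf
    have hK : 0 ≤ c * (1 / 2 : ℝ) ^ (-(d / 2)) := by positivity
    rw [← sq_le_sq₀ (norm_nonneg _) (by positivity), norm_toL2_sq, mul_pow, Real.sq_sqrt hK]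
    have e1 : (T (1 / 4) f - expect μ f • (1 : Linf μ)) * (T (1 / 4) f - expect μ f • (1 : Linf μ))
        = T (1 / 4) f * T (1 / 4) f - (2 * expect μ f) • T (1 / 4) f
          + (expect μ f ^ 2) • (1 : Linf μ) := by
      simp only [sub_mul, mul_sub, smul_mul_assoc, mul_smul_comm, one_mul, mul_one]; module
    -- Time `1/4` brings the `L_1 → L_∞` bound at time `1/2` into play: `⟨f, T_{1/2} f⟩ ≤ ‖T_{1/2}
    -- f‖_∞ ∫ f`. Its square root is the `L_1 → L_2` norm bound.
    have e2 : expect μ (T (1 / 4) f * T (1 / 4) f) = expect μ (f * T (1 / 2) f) := by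
      rw [← hs.expect_symm (by norm_num), ← hT.add_apply (by norm_num) (by norm_num)]
      norm_num
    have h1 : expect μ (f * T (1 / 2) f) ≤ ‖T (1 / 2) f‖ * expect μ f := by
      have h2 := linf_mul_nonneg hf (sub_nonneg.2 (linf_le_norm_smul_one (T (1 / 2) f)))
      have h3 := expect_nonneg h2
      rw [mul_sub, mul_smul_comm, mul_one, map_sub, map_smul, smul_eq_mul] at h3
      linarith
    have h2 := hV (1 / 2) (by norm_num) (by norm_num) f
    rw [expect_abs hf] at h2
    have h3 := mul_le_mul_of_nonneg_right h2 hf0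
    rw [e1, map_add, map_sub, map_smul, map_smul, hE, expect_one, e2, smul_eq_mul, smul_eq_mul]
    nlinarith

/-- Ultracontractivity and the spectral gap bound the semigroup below by the expectation. -/
lemma half_expect_le_map (hT : IsMarkovSemigroup T) (hs : IsSymmetricSemigroup T)
    {c d : ℝ} (hV : VaropoulosBound T c d) (hc : 0 < c) {σ : ℝ}
    (hσ : 0 < σ) (hgap : HasSpectralGap T σ) {τ : ℝ} (hτ : 0 ≤ τ)
    (hK : c * (1 / 2) ^ (-(d / 2)) * Real.exp (-(σ * τ)) ≤ 1 / 2) {f : Linf μ} (hf : 0 ≤ f) :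
    (expect μ f / 2) • (1 : Linf μ) ≤ T (1 / 2 + τ) f := by
  -- Lower bound by duality. Splitting `1/2 + τ = 1/4 + τ + 1/4` puts one smoothing factor on each
  -- of `f` and `h`; centering leaves `⟨h, T f⟩ - (∫ h)(∫ f) = ⟨h₁, T_τ f₁⟩`, to which the gap
  -- applies.
  have key : ∀ h : Linf μ, 0 ≤ h →
      0 ≤ expect μ (h * (T (1 / 2 + τ) f - (expect μ f / 2) • (1 : Linf μ))) := by
    intro h hh
    obtain ⟨gf, hgf, hgf0, hgfn⟩ := exists_centered hT hs hV hc hf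
    obtain ⟨gh, hgh, hgh0, hghn⟩ := exists_centered hT hs hV hc hh
    set f₁ := T (1 / 4) f - expect μ f • (1 : Linf μ) with hf₁
    set h₁ := T (1 / 4) h - expect μ h • (1 : Linf μ) with hh₁
    have e1 : expect μ (h₁ * T τ f₁)
        = expect μ (h * T (1 / 2 + τ) f) - expect μ h * expect μ f := by
      have e2 : T (1 / 2 + τ) f = T (1 / 4) (T τ (T (1 / 4) f)) := by
        rw [← hT.add_apply hτ (by norm_num), ← hT.add_apply (by norm_num) (by positivity)]
        congr 2; ring
      have e3 : expect μ (h₁ * T τ f₁) = expect μ (h₁ * T τ (T (1 / 4) f)) := by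
        rw [hf₁, map_sub, map_smul, hT.map_one hτ, mul_sub, mul_smul_comm, mul_one, map_sub,
          map_smul, hgh0, smul_zero, sub_zero]
      rw [e3, e2, hs.expect_symm (by norm_num : (0:ℝ) ≤ 1 / 4) h, hh₁, sub_mul, smul_mul_assoc,
        one_mul, map_sub, map_smul, expect_map hT hs hτ, expect_map hT hs (by norm_num),
        smul_eq_mul]
    have b1 : |expect μ (h₁ * T τ f₁)| ≤ ‖toL2 μ h₁‖ * ‖toL2 μ (T τ f₁)‖ := by
      rw [← inner_toL2]; exact abs_real_inner_le_norm _ _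
    have b2 := norm_toL2_map_le_exp hT hs hσ hgap hgf hgf0 hτ
    have hKn : 0 ≤ c * (1 / 2 : ℝ) ^ (-(d / 2)) := by positivity
    have hf0 := expect_nonneg hf
    have hh0 := expect_nonneg hh
    have b3 : ‖toL2 μ h₁‖ * ‖toL2 μ (T τ f₁)‖ ≤ (expect μ h * expect μ f) * (1 / 2) := by
      calc ‖toL2 μ h₁‖ * ‖toL2 μ (T τ f₁)‖
          ≤ (√(c * (1 / 2) ^ (-(d / 2))) * expect μ h) * (Real.exp (-(σ * τ))
            * (√(c * (1 / 2) ^ (-(d / 2))) * expect μ f)) := by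
            gcongr
            exact b2.trans (mul_le_mul_of_nonneg_left hgfn (Real.exp_pos _).le)
        _ = (expect μ h * expect μ f) * ((√(c * (1 / 2) ^ (-(d / 2)))
            * √(c * (1 / 2) ^ (-(d / 2)))) * Real.exp (-(σ * τ))) := by ring
        _ ≤ (expect μ h * expect μ f) * (1 / 2) := by
            rw [Real.mul_self_sqrt hKn]
            exact mul_le_mul_of_nonneg_left hK (mul_nonneg hh0 hf0)
    have b4 := neg_abs_le (expect μ (h₁ * T τ f₁))
    rw [mul_sub, mul_smul_comm, mul_one, map_sub, map_smul, smul_eq_mul]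
    linarith
  rw [← sub_nonneg, linf_nonneg_iff]
  refine ae_nonneg_of_forall_setIntegral_nonneg (linf_integrable _) fun s hs' _ => ?_
  obtain ⟨h, hh⟩ := exists_linf (μ := μ) (u := s.indicator fun _ => (1 : ℝ)) (C := 1)
    ((measurable_const.indicator hs').aestronglyMeasurable)
    (Eventually.of_forall fun x => by
      by_cases hx : x ∈ s <;> simp [hx])
  have h0 : 0 ≤ h := linf_nonneg_iff.2 (by
    filter_upwards [hh] with x hx
    rw [hx]; exact Set.indicator_nonneg (fun _ _ => zero_le_one) x)
  have h1 := key h h0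
  rw [expect_mul] at h1
  rw [← integral_indicator hs']
  refine h1.trans_eq (integral_congr_ae ?_)
  filter_upwards [hh] with x hx
  rw [hx]
  by_cases hx' : x ∈ s <;> simp [hx']

/-- Test on the constant function and let `t ↑ 1`. This makes `log c ≥ 0`, so the mixing time is
nonnegative. -/
lemma VaropoulosBound.one_le {c d : ℝ} (hT : IsMarkovSemigroup T) (hV : VaropoulosBound T c d) :
    1 ≤ c := by
  have h1 : ∀ t : ℝ, 0 < t → t < 1 → 1 ≤ c * t ^ (-(d / 2)) := by
    intro t h0 h1
    have h2 := hV t h0 h1 1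
    rw [hT.map_one h0.le, expect_abs linf_one_nonneg, expect_one, mul_one] at h2
    refine le_trans ?_ h2
    have h3 := expect_mono (linf_le_norm_smul_one (1 : Linf μ))
    rwa [map_smul, expect_one, smul_eq_mul, mul_one] at h3
  have hc : Tendsto (fun t : ℝ => c * t ^ (-(d / 2))) (𝓝[<] 1) (𝓝 (c * 1 ^ (-(d / 2)))) :=
    ((Real.continuousAt_rpow_const 1 (-(d / 2)) (Or.inl one_ne_zero)).tendsto.mono_left
      nhdsWithin_le_nhds).const_mul c
  rw [Real.one_rpow, mul_one] at hc
  refine ge_of_tendsto hc ?_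
  filter_upwards [Ioo_mem_nhdsLT (zero_lt_one' ℝ)] with t ht
  exact h1 t ht.1 ht.2

end Gap

/-! ### The explicit constants -/

section Constants

/-- `∫₀ᵗ e^{-2 λ s} ds`. -/
def expPrimitive (lam t : ℝ) : ℝ :=
  if lam = 0 then t else (1 - Real.exp (-(2 * lam * t))) / (2 * lam)

lemma expPrimitive_zero (lam : ℝ) : expPrimitive lam 0 = 0 := by
  simp [expPrimitive]

lemma hasDerivAt_expPrimitive (lam s : ℝ) :
    HasDerivAt (expPrimitive lam) (Real.exp (-(2 * lam * s))) s := by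
  by_cases h : lam = 0
  · have e : expPrimitive lam = fun t => t := by ext t; simp [expPrimitive, h]
    rw [e, h]
    simpa using! hasDerivAt_id s
  · have e : expPrimitive lam = fun t => (1 - Real.exp (-(2 * lam * t))) / (2 * lam) := by
      ext t; simp [expPrimitive, h]
    rw [e]
    have e1 : HasDerivAt (fun s => -(2 * lam * s)) (-(2 * lam)) s := by
      simpa using! ((hasDerivAt_id s).const_mul (2 * lam)).neg
    have h1 := (e1.exp.const_sub 1).div_const (2 * lam)
    have e2 : -(Real.exp (-(2 * lam * s)) * -(2 * lam)) / (2 * lam)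
        = Real.exp (-(2 * lam * s)) := by field_simp
    rwa [e2] at h1

lemma expPrimitive_pos (lam : ℝ) {t : ℝ} (ht : 0 < t) : 0 < expPrimitive lam t := by
  have hm : StrictMono (expPrimitive lam) := strictMono_of_deriv_pos fun s => by
    rw [(hasDerivAt_expPrimitive lam s).deriv]; exact Real.exp_pos _
  have := hm ht
  rwa [expPrimitive_zero] at this

lemma mlsiConstant_eq {c d σ : ℝ} (hc : 0 < c) (hσ : 0 < σ) (lam : ℝ) :
    mlsiConstant c d σ lam
      = (4 * expPrimitive lam (1 / 2 + ((d + 2) / 2 * Real.log 2 + Real.log c) / σ))⁻¹ := by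
  by_cases h : lam = 0
  · simp only [mlsiConstant, expPrimitive, h, if_true]
    congr 1
    field_simp
    ring
  · simp only [mlsiConstant, expPrimitive, h, if_false]
    rw [Real.rpow_def_of_pos two_pos, Real.rpow_def_of_pos hc, ← Real.exp_add, ← Real.exp_add]
    have e : Real.exp (-lam + Real.log 2 * (1 - (d + 2) * lam / σ)
          + Real.log c * -(2 * lam / σ))
        = 2 * Real.exp (-(2 * lam * (1 / 2 + ((d + 2) / 2 * Real.log 2 + Real.log c) / σ))) := by
      have e2 : -lam + Real.log 2 * (1 - (d + 2) * lam / σ) + Real.log c * -(2 * lam / σ)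
          = Real.log 2
            + -(2 * lam * (1 / 2 + ((d + 2) / 2 * Real.log 2 + Real.log c) / σ)) := by
        field_simp
        ring
      rw [e2, Real.exp_add, Real.exp_log two_pos]
    rw [e]
    set E := Real.exp (-(2 * lam * (1 / 2 + ((d + 2) / 2 * Real.log 2 + Real.log c) / σ)))
    have e2 : 4 * ((1 - E) / (2 * lam)) = (2 - 2 * E) / lam := by field_simp; ring
    rw [e2, inv_div, div_eq_mul_inv]

/-- Equality holds: `τ` solves `c 2^{d/2} e^{-σ τ} = 1/2`. -/
lemma mixing_time_bound {c d σ : ℝ} (hc : 0 < c) (hσ : 0 < σ) :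
    c * (1 / 2) ^ (-(d / 2))
      * Real.exp (-(σ * (((d + 2) / 2 * Real.log 2 + Real.log c) / σ))) ≤ 1 / 2 := by
  have e : (1 / 2 : ℝ) ^ (-(d / 2)) = Real.exp (d / 2 * Real.log 2) := by
    rw [Real.rpow_def_of_pos (by norm_num), one_div, Real.log_inv]
    congr 1; ring
  have e1 : -(σ * (((d + 2) / 2 * Real.log 2 + Real.log c) / σ))
      = -(d / 2 * Real.log 2) + (-Real.log 2 + -Real.log c) := by field_simp; ring
  rw [e, e1, Real.exp_add, Real.exp_add, Real.exp_neg, Real.exp_neg, Real.exp_neg,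
    Real.exp_log two_pos, Real.exp_log hc]
  apply le_of_eq
  have := Real.exp_pos (d / 2 * Real.log 2)
  field_simp

end Constants

/-! ### The modified logarithmic Sobolev inequality -/

theorem satisfiesMLSI_mlsiConstant {T : ℝ → Linf μ →L[ℝ] Linf μ} (hT : IsMarkovSemigroup T)
    (hsymm : IsSymmetricSemigroup T) (hdiff : IsDiffusion T) {lam : ℝ}
    (hCD : CurvatureDimension T lam) {c d : ℝ} (hc : 0 < c) (hd : 0 < d)
    (hVar : VaropoulosBound T c d) {σ : ℝ} (hσ : 0 < σ) (hgap : HasSpectralGap T σ) :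
    SatisfiesMLSI T (mlsiConstant c d σ lam) := by
  set τ := ((d + 2) / 2 * Real.log 2 + Real.log c) / σ with hτdef
  have hτ : 0 ≤ τ := by
    have h1 := Real.log_nonneg (hVar.one_le hT)
    have h2 := Real.log_pos one_lt_two
    rw [hτdef]; positivity
  have hκ : 0 < expPrimitive lam (1 / 2 + τ) := expPrimitive_pos lam (by positivity)
  rw [SatisfiesMLSI, mlsiConstant_eq hc hσ]
  refine ⟨by positivity, ?_⟩
  rintro ρ Aρ ⟨a, ha, h⟩ hρ1 hρ
  have ht : 0 ≤ 1 / 2 + τ := by positivity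
  have h1 := entropy_sub_le_fisher hT hsymm hdiff hCD hVar hc ha h hρ (expPrimitive_zero lam)
    (hasDerivAt_expPrimitive lam) ht
  have h2 := entropy_half (P := T (1 / 2 + τ))
    (fun f hf => half_expect_le_map hT hsymm hVar hc hσ hgap hτ (mixing_time_bound hc hσ) hf)
    (hT.map_one ht) (fun f => expect_map hT hsymm ht f) ha h (by rw [expect_apply, hρ1])
  rw [← hτdef]
  -- With this form of `2 m D`, the claim is `D(ρ) / 2 ≤ κ(1/2 + τ) I(ρ)`, the combination of `h1`
  -- and `h2`.
  have e : ∀ D : ℝ, 2 * (4 * expPrimitive lam (1 / 2 + τ))⁻¹ * D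
      = (D / 2) / expPrimitive lam (1 / 2 + τ) := fun D => by field_simp; norm_num
  rw [e, div_le_iff₀ hκ]
  linarith

end DiffusionMLSI

end

theorem theorem4p1 {Ω : Type*} [MeasurableSpace Ω] (μ : MeasureTheory.Measure Ω)
    [MeasureTheory.IsProbabilityMeasure μ]
    (T : ℝ → DiffusionMLSI.Linf μ →L[ℝ] DiffusionMLSI.Linf μ)
    (hT : DiffusionMLSI.IsMarkovSemigroup T)
    (hsymm : DiffusionMLSI.IsSymmetricSemigroup T)
    (herg : DiffusionMLSI.IsErgodicSemigroup T)
    (hdiff : DiffusionMLSI.IsDiffusion T)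
    (lam : ℝ) (hCD : DiffusionMLSI.CurvatureDimension T lam)
    (c d : ℝ) (hc : 0 < c) (hd : 0 < d) (hVar : DiffusionMLSI.VaropoulosBound T c d)
    (σ : ℝ) (hσ : 0 < σ) (hgap : DiffusionMLSI.HasSpectralGap T σ) :
    DiffusionMLSI.SatisfiesMLSI T (DiffusionMLSI.mlsiConstant c d σ lam) :=
  DiffusionMLSI.satisfiesMLSI_mlsiConstant hT hsymm hdiff hCD hc hd hVar hσ hgap
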